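/- Let $\mathsf G=(\mathsf G_1\rightrightarrows \mathsf G_0)$ be an orbifold groupoid, i.e. a proper étale smooth groupoid ($s,t$ local diffeomorphisms, $(s,t):\mathsf G_1\to\mathsf G_0\times\mathsf G_0$ proper), where $ab$ is defined when $t(a)=s(b)$. Let $(\mathcal L,\theta)$ be a gerbe over $\mathsf G$: a smooth complex line bundle $\mathcal L\to \mathsf G_1$ together with isomorphisms $\theta_{a,b}:\mathcal L_a\otimes\mathcal L_b\cong\mathcal L_{ab}$, smooth in the composable pair $(a,b)$, which satisfy the cocycle (associativity) condition on composable triples. (If $\mathcal L$ is trivial, $\theta$ is a function with $\theta(a,b)\theta(ab,c)=\theta(a,bc)\theta(b,c)$.) The inertia groupoid $\wedge\mathsf G$ has objects $\wedge\mathsf G_0=\{a\in\mathsf G_1: s(a)=t(a)\}$, and its arrows $v:a\to b$ are the $v\in\mathsf G_1$ with $av=vb$. For such $v$ let $\rho(a,v):\mathcal L_a\to\mathcal L_b$ be the isomorphism with $\theta_{a,v}(u\otimes w)=\theta_{v,b}(w\otimes\rho(a,v)u)$ for all $u\in\mathcal L_a$, $w\in\mathcal L_v$ (for trivial $\mathcal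 L$: $\rho(a,v)=\theta(a,v)/\theta(v,v^{-1}av)$). Let the twisted sectors $\widetilde{\Sigma_1\mathsf G}$ be presented as the full subgroupoid of $\wedge\mathsf G$ on an open set $S\subset\wedge\mathsf G_0$ that meets every isomorphism class of objects of $\wedge\mathsf G$ (in an orbifold chart $(V,K)$ one chooses one $g$ in each conjugacy class of $K$ and obtains $\bigsqcup_{(g)}V^g\rtimes C(g)$). Then the line bundle obtained from $\mathcal L|_{S}$ with the gluing maps $\rho$ is an inner local system over $\widetilde{\Sigma_1\mathsf G}$. That is: the maps $\rho$ are functorial, so that they define a complex line orbibundle over $\widetilde{\Sigma_1\mathsf G}$, and this orbibundle carries a flat structure (local frames of $\mathcal L|_S$, each locally the restriction of a smooth section of $\mathcal L$, that differ by locally constant factors and with respect to which $\rho$ is locally constant) such that, writing $L_{(g)}$ for its restriction to the sector $X_{(g)}$, there are isomorphisms of flat line orbibundles 1. $L_{(1)}\cong 1$ over the nontwisted sector; 2. $I^*L_{(g^{-1})}\cong L_{(g)}^{-1}$, where $I:X_{(g)}\to X_{(g^{-1})}$ is induced by $g\mapsto g^{-1}$; 3. $e_1^*L_{(g_1)}\otimes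 e_2^*L_{(g_2)}\otimes e_3^*L_{(g_3)}\cong 1$ over the triple sectors $X_{(g_1,g_2,g_3)}$ with $g_1g_2g_3=1$, where $e_i$ is induced by $(g_1,g_2,g_3)\mapsto g_i$. -/

import Mathlib

open scoped Manifold ContDiff Topology
open Bundle

/-- A map defined on a subset `A` of a manifold `M` is smooth if near every point of `A` it is the
restriction of a smooth map defined on an open subset of `M`.  For an embedded submanifold `A` this
is smoothness in the intrinsic sense. -/
def SmoothOnSubset {E H M E' H' N : Type*}
    [NormedAddCommGroup E] [NormedSpace ℝ E] [TopologicalSpace H]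
    [TopologicalSpace M] [ChartedSpace H M]
    [NormedAddCommGroup E'] [NormedSpace ℝ E'] [TopologicalSpace H']
    [TopologicalSpace N] [ChartedSpace H' N]
    (I : ModelWithCorners ℝ E H) (J : ModelWithCorners ℝ E' H') (A : Set M) (f : A → N) : Prop :=
  ∀ p : A, ∃ U : Set M, IsOpen U ∧ p.1 ∈ U ∧
    ∃ F : M → N, ContMDiffOn I J ∞ F U ∧ ∀ q : A, q.1 ∈ U → F q.1 = f q

/-- A proper étale smooth groupoid with manifold of objects `G₀` and manifold of arrows `G₁`, both
without boundary and modelled on `E`.  The product `mul a b` is defined when the target of `a` is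
the source of `b` (first `a`, then `b`). -/
structure OrbifoldGroupoid (E G₀ G₁ : Type*)
    [NormedAddCommGroup E] [NormedSpace ℝ E]
    [TopologicalSpace G₀] [ChartedSpace E G₀] [TopologicalSpace G₁] [ChartedSpace E G₁] where
  s : G₁ → G₀
  t : G₁ → G₀
  e : G₀ → G₁
  inv : G₁ → G₁
  mul : ∀ a b : G₁, t a = s b → G₁
  s_e : ∀ x, s (e x) = x
  t_e : ∀ x, t (e x) = x
  s_inv : ∀ a, s (inv a) = t a
  t_inv : ∀ a, t (inv a) = s a
  s_mul : ∀ a b h, s (mul a b h) = s a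
  t_mul : ∀ a b h, t (mul a b h) = t b
  mul_assoc : ∀ a b c (hab : t a = s b) (hbc : t b = s c),
    mul (mul a b hab) c ((t_mul a b hab).trans hbc) =
      mul a (mul b c hbc) (hab.trans (s_mul b c hbc).symm)
  e_mul : ∀ a, mul (e (s a)) a (t_e (s a)) = a
  mul_e : ∀ a, mul a (e (t a)) (s_e (t a)).symm = a
  mul_inv : ∀ a, mul a (inv a) (s_inv a).symm = e (s a)
  inv_mul : ∀ a, mul (inv a) a (t_inv a) = e (t a)
  /-- étale -/
  s_etale : IsLocalDiffeomorph 𝓘(ℝ, E) 𝓘(ℝ, E) ∞ s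
  t_etale : IsLocalDiffeomorph 𝓘(ℝ, E) 𝓘(ℝ, E) ∞ t
  e_smooth : ContMDiff 𝓘(ℝ, E) 𝓘(ℝ, E) ∞ e
  inv_smooth : ContMDiff 𝓘(ℝ, E) 𝓘(ℝ, E) ∞ inv
  mul_smooth : SmoothOnSubset (𝓘(ℝ, E).prod 𝓘(ℝ, E)) 𝓘(ℝ, E)
    {p : G₁ × G₁ | t p.1 = s p.2} (fun p => mul p.1.1 p.1.2 p.2)
  /-- proper -/
  proper : IsProperMap (fun a : G₁ => (s a, t a))

namespace OrbifoldGroupoid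

variable {E G₀ G₁ : Type*} [NormedAddCommGroup E] [NormedSpace ℝ E]
  [TopologicalSpace G₀] [ChartedSpace E G₀] [TopologicalSpace G₁] [ChartedSpace E G₁]

/-- The objects of the inertia groupoid `∧G`: arrows of `G` with equal source and target, with the
subspace topology. -/
abbrev Loop (G : OrbifoldGroupoid E G₀ G₁) : Type _ := {a : G₁ // G.s a = G.t a}

/-- `v` is an arrow of the inertia groupoid from `a` to `b`, that is, `a v = v b`. -/
def IsInertiaArrow (G : OrbifoldGroupoid E G₀ G₁) (a : G.Loop) (v : G₁) (b : G.Loop) : Prop :=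
  ∃ (h : G.t a.1 = G.s v) (h' : G.t v = G.s b.1), G.mul a.1 v h = G.mul v b.1 h'

theorem isInertiaArrow_id (G : OrbifoldGroupoid E G₀ G₁) (a : G.Loop) :
    G.IsInertiaArrow a (G.e (G.s a.1)) a := by
  refine ⟨a.2.symm.trans (G.s_e _).symm, G.t_e _, ?_⟩
  rw [G.e_mul]
  have key : ∀ (y : G₀) (h : G.t a.1 = G.s (G.e y)), y = G.t a.1 →
      G.mul a.1 (G.e y) h = a.1 := by
    rintro y h rfl
    exact G.mul_e _
  exact key _ _ a.2

theorem IsInertiaArrow.comp {G : OrbifoldGroupoid E G₀ G₁} {a b c : G.Loop} {v w : G₁}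
    (hv : G.IsInertiaArrow a v b) (hw : G.IsInertiaArrow b w c) (h : G.t v = G.s w) :
    G.IsInertiaArrow a (G.mul v w h) c := by
  obtain ⟨h1, h2, h3⟩ := hv
  obtain ⟨k1, k2, k3⟩ := hw
  refine ⟨h1.trans (G.s_mul _ _ _).symm, (G.t_mul _ _ _).trans k2, ?_⟩
  rw [← G.mul_assoc a.1 v w h1 h, G.mul_assoc v w c.1 h k2]
  have e1 : ∀ (x y : G₁) (hx : G.t x = G.s w) (hy : G.t y = G.s w), x = y →
      G.mul x w hx = G.mul y w hy := by
    rintro x y hx hy rfl; rfl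
  have e2 : ∀ (x y : G₁) (hx : G.t v = G.s x) (hy : G.t v = G.s y), x = y →
      G.mul v x hx = G.mul v y hy := by
    rintro x y hx hy rfl; rfl
  rw [e1 _ _ _ ((G.t_mul v b.1 h2).trans k1) h3, G.mul_assoc v b.1 w h2 k1]
  exact e2 _ _ _ _ k3

/-- A set `S` of objects of `∧G` presents the twisted sectors as the full subgroupoid of `∧G` on
`S` when `S` is open and every object of `∧G` is isomorphic in `∧G` to one in `S`; the inclusion is
then a Morita equivalence.  In an orbifold chart `(V, K)`, where the objects of `∧G` are the
`⊔_{g ∈ K} V^g × {g}`, choosing one `g` in each conjugacy class of `K` gives the usual sectors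
`⊔_{(g)} V^g ⋊ C(g)`.  The choice `S = univ` is allowed as well. -/
structure IsTwistedSectors (G : OrbifoldGroupoid E G₀ G₁) (S : Set G.Loop) : Prop where
  isOpen : IsOpen S
  meets_orbits : ∀ a : G.Loop, ∃ b ∈ S, ∃ v, G.IsInertiaArrow a v b

/-- The space of arrows of the full subgroupoid of `∧G` on `S`: triples `(a, v, b)` with
`a, b ∈ S` and `v : a ⟶ b`. -/
abbrev SectorArrow (G : OrbifoldGroupoid E G₀ G₁) (S : Set G.Loop) : Type _ :=
  {p : S × G₁ × S // G.IsInertiaArrow p.1.1 p.2.1 p.2.2.1}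

/-- `g₁, …, gₙ` are loops at one common point and `g₁ ⋯ gₙ = 1`; the `p i` are the partial
products. -/
def HasUnitProduct (G : OrbifoldGroupoid E G₀ G₁) {n : ℕ} (g : Fin n → G.Loop) : Prop :=
  ∃ (x : G₀) (p : Fin (n + 1) → G₁), p 0 = G.e x ∧ p (Fin.last n) = G.e x ∧
    ∀ i : Fin n, ∃ h : G.t (p i.castSucc) = G.s (g i).1,
      p i.succ = G.mul (p i.castSucc) (g i).1 h

/-- Objects of the multisector of `n`-tuples `(g₁, …, gₙ)` with `g₁ ⋯ gₙ = 1`, presented so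
that the `n` evaluation maps `eᵢ : (g₁, …, gₙ) ↦ gᵢ` become maps to the groupoid on `S`: besides
the tuple `g` an object records arrows `vᵢ : gᵢ ⟶ bᵢ` of `∧G` with `bᵢ ∈ S`, and `eᵢ` sends it to
`bᵢ`.  (It is the fibre product, in the sense of groupoids, of the multisector and `Sⁿ` over
`(∧G)ⁿ`, so it is Morita equivalent to the multisector.) -/
abbrev MultiSector (G : OrbifoldGroupoid E G₀ G₁) (S : Set G.Loop) (n : ℕ) : Type _ :=
  {q : (Fin n → G.Loop) × (Fin n → G₁) × (Fin n → S) //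
    G.HasUnitProduct q.1 ∧ ∀ i, G.IsInertiaArrow (q.1 i) (q.2.1 i) (q.2.2 i).1}

/-- Arrows between objects `q = (g, v, b)` and `q' = (g', v', b')` of the multisector: an arrow `z`
of `G` that conjugates every `gᵢ` to `g'ᵢ`, and arrows `yᵢ : bᵢ ⟶ b'ᵢ` with `vᵢ yᵢ = z v'ᵢ`.  The
evaluation map `eᵢ` sends it to `yᵢ`. -/
def IsMultiSectorArrow (G : OrbifoldGroupoid E G₀ G₁) {S : Set G.Loop} {n : ℕ}
    (q q' : G.MultiSector S n) (z : G₁) (y : Fin n → G₁) : Prop :=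
  ∀ i, G.IsInertiaArrow (q.1.1 i) z (q'.1.1 i) ∧
    G.IsInertiaArrow (q.1.2.2 i).1 (y i) (q'.1.2.2 i).1 ∧
    ∃ (h : G.t (q.1.2.1 i) = G.s (y i)) (h' : G.t z = G.s (q'.1.2.1 i)),
      G.mul (q.1.2.1 i) (y i) h = G.mul z (q'.1.2.1 i) h'

/-- A flat complex line orbibundle over the full subgroupoid of `∧G` on `S`, with fibres `F a`: the
arrows act functorially and linearly, and the flat structure is an atlas of nowhere vanishing local
frames (the flat ones) which differ by locally constant factors and with respect to which the arrows
act by locally constant factors. -/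
structure FlatLineOrbibundle (G : OrbifoldGroupoid E G₀ G₁) (S : Set G.Loop)
    (F : S → Type*) [∀ a, AddCommGroup (F a)] [∀ a, Module ℂ (F a)] where
  finrank_eq_one : ∀ a, Module.finrank ℂ (F a) = 1
  act : ∀ (a b : S) (v : G₁), G.IsInertiaArrow a.1 v b.1 → (F a →ₗ[ℂ] F b)
  act_id : ∀ (a : S) (u : F a), act a a (G.e (G.s a.1.1)) (G.isInertiaArrow_id a.1) u = u
  act_comp : ∀ (a b c : S) (v w : G₁) (hv : G.IsInertiaArrow a.1 v b.1)
    (hw : G.IsInertiaArrow b.1 w c.1) (h : G.t v = G.s w) (u : F a),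
    act a c (G.mul v w h) (hv.comp hw h) u = act b c w hw (act a b v hv u)
  /-- `IsFrame U σ`: the values of `σ` on `U` form a flat frame; values outside `U` are
  irrelevant. -/
  IsFrame : Set S → (∀ a, F a) → Prop
  isOpen_of_isFrame : ∀ U σ, IsFrame U σ → IsOpen U
  frame_ne_zero : ∀ U σ, IsFrame U σ → ∀ a ∈ U, σ a ≠ 0
  exists_frame : ∀ a, ∃ U σ, IsFrame U σ ∧ a ∈ U
  frame_compat : ∀ U σ V τ, IsFrame U σ → IsFrame V τ → ∀ a ∈ U ∩ V, ∀ c : ℂ,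
    τ a = c • σ a → ∀ᶠ b in 𝓝 a, τ b = c • σ b
  act_flat : ∀ U σ V τ, IsFrame U σ → IsFrame V τ → ∀ p : G.SectorArrow S,
    p.1.1 ∈ U → p.1.2.2 ∈ V → ∀ c : ℂ,
    act p.1.1 p.1.2.2 p.1.2.1 p.2 (σ p.1.1) = c • τ p.1.2.2 →
    ∀ᶠ q : G.SectorArrow S in 𝓝 p,
      act q.1.1 q.1.2.2 q.1.2.1 q.2 (σ q.1.1) = c • τ q.1.2.2

/-- A flat trivialization of the line orbibundle `e₁^* F ⊗ ⋯ ⊗ eₙ^* F` over the multisector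
`g₁ ⋯ gₙ = 1`: fibrewise a nowhere vanishing `n`-linear form, invariant under the arrows of the
multisector and locally constant in flat frames. -/
structure FlatTrivialization {G : OrbifoldGroupoid E G₀ G₁} {S : Set G.Loop}
    {F : S → Type*} [∀ a, AddCommGroup (F a)] [∀ a, Module ℂ (F a)]
    (B : G.FlatLineOrbibundle S F) (n : ℕ) where
  form : ∀ q : G.MultiSector S n, MultilinearMap ℂ (fun i => F (q.1.2.2 i)) ℂ
  form_ne_zero : ∀ q u, (∀ i, u i ≠ 0) → form q u ≠ 0
  form_invariant : ∀ (q q' : G.MultiSector S n) (z : G₁) (y : Fin n → G₁)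
    (h : G.IsMultiSectorArrow q q' z y) (u : ∀ i, F (q.1.2.2 i)),
    form q' (fun i => B.act (q.1.2.2 i) (q'.1.2.2 i) (y i) (h i).2.1 (u i)) = form q u
  form_flat : ∀ (U : Fin n → Set S) (σ : Fin n → ∀ a, F a), (∀ i, B.IsFrame (U i) (σ i)) →
    ∀ q : G.MultiSector S n, (∀ i, q.1.2.2 i ∈ U i) →
    ∀ᶠ r : G.MultiSector S n in 𝓝 q,
      form r (fun i => σ i (r.1.2.2 i)) = form q (fun i => σ i (q.1.2.2 i))

/-- An inner local system over the twisted sectors presented by `S`, with fibres `F`: a flat complex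
line orbibundle such that, as flat line orbibundles,
* its restriction to the nontwisted sector `g = 1` is trivial;
* `L_(g) ⊗ I^* L_(g⁻¹)` is trivial, `I : X_(g) → X_(g⁻¹)` being the inversion `g ↦ g⁻¹`
  (pairs with `g₁ g₂ = 1` are pairs `(g, g⁻¹)`);
* `e₁^* L_(g₁) ⊗ e₂^* L_(g₂) ⊗ e₃^* L_(g₃)` is trivial over the triple sectors with
  `g₁ g₂ g₃ = 1`. -/
structure InnerLocalSystem (G : OrbifoldGroupoid E G₀ G₁) (S : Set G.Loop)
    (F : S → Type*) [∀ a, AddCommGroup (F a)] [∀ a, Module ℂ (F a)]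
    extends G.FlatLineOrbibundle S F where
  nontwisted : FlatTrivialization toFlatLineOrbibundle 1
  inversion : FlatTrivialization toFlatLineOrbibundle 2
  triple : FlatTrivialization toFlatLineOrbibundle 3

/-- A gerbe over `G` whose line bundle over `G₁` is `L`: isomorphisms
`θ_{a,b} : L_a ⊗ L_b ≅ L_{ab}` depending smoothly on the composable pair `(a, b)` and satisfying the
cocycle condition, that is, associativity over composable triples.  For the trivial bundle `L`, `θ`
is a smooth function with `θ(a,b) θ(ab,c) = θ(a,bc) θ(b,c)`. -/
structure Gerbe (G : OrbifoldGroupoid E G₀ G₁) (L : G₁ → Type*)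
    [∀ a, AddCommGroup (L a)] [∀ a, Module ℂ (L a)] [∀ a, TopologicalSpace (L a)]
    [TopologicalSpace (TotalSpace ℂ L)] [FiberBundle ℂ L] where
  θ : ∀ (a b : G₁) (h : G.t a = G.s b), L a →ₗ[ℂ] L b →ₗ[ℂ] L (G.mul a b h)
  θ_ne_zero : ∀ a b h (u : L a) (w : L b), u ≠ 0 → w ≠ 0 → θ a b h u w ≠ 0
  cocycle : ∀ a b c (hab : G.t a = G.s b) (hbc : G.t b = G.s c) (u : L a) (v : L b) (w : L c),
    (TotalSpace.mk' ℂ _ (θ (G.mul a b hab) c ((G.t_mul a b hab).trans hbc) (θ a b hab u v) w) :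
        TotalSpace ℂ L) =
      TotalSpace.mk' ℂ _ (θ a (G.mul b c hbc) (hab.trans (G.s_mul b c hbc).symm) u (θ b c hbc v w))
  smooth : SmoothOnSubset
    ((𝓘(ℝ, E).prod 𝓘(ℝ, ℂ)).prod (𝓘(ℝ, E).prod 𝓘(ℝ, ℂ))) (𝓘(ℝ, E).prod 𝓘(ℝ, ℂ))
    {p : TotalSpace ℂ L × TotalSpace ℂ L | G.t p.1.proj = G.s p.2.proj}
    (fun p => TotalSpace.mk' ℂ _ (θ p.1.1.proj p.1.2.proj p.2 p.1.1.snd p.1.2.snd))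

namespace Gerbe

variable {G : OrbifoldGroupoid E G₀ G₁} {L : G₁ → Type*}
  [∀ a, AddCommGroup (L a)] [∀ a, Module ℂ (L a)] [∀ a, TopologicalSpace (L a)]
  [TopologicalSpace (TotalSpace ℂ L)] [FiberBundle ℂ L]

theorem exists_rho [VectorBundle ℂ ℂ L] (g : G.Gerbe L) (a b : G.Loop) (v : G₁)
    (hv : G.IsInertiaArrow a v b) :
    ∃! r : L a.1 →ₗ[ℂ] L b.1, ∀ (u : L a.1) (w : L v),
      (TotalSpace.mk' ℂ _ (g.θ a.1 v hv.choose u w) : TotalSpace ℂ L) =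
        TotalSpace.mk' ℂ _ (g.θ v b.1 hv.choose_spec.choose w (r u)) := by
  have fr : ∀ x : G₁, Module.finrank ℂ (L x) = 1 := fun x => by
    rw [((trivializationAt ℂ L x).linearEquivAt ℂ x
      (mem_baseSet_trivializationAt ℂ L x)).finrank_eq]
    exact Module.finrank_self ℂ
  have fd : ∀ x : G₁, FiniteDimensional ℂ (L x) := fun x =>
    FiniteDimensional.of_finrank_eq_succ (fr x)
  generalize hv.choose_spec.choose = h2
  have h3 : G.mul a.1 v hv.choose = G.mul v b.1 h2 := hv.choose_spec.choose_spec
  generalize hv.choose = h1 at h3 ⊢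
  obtain ⟨w₀, hw₀, hspan⟩ := finrank_eq_one_iff'.1 (fr v)
  have cast : ∀ x y : G₁, x = y → ∃ c : L x →ₗ[ℂ] L y, ∀ z,
      (TotalSpace.mk' ℂ y (c z) : TotalSpace ℂ L) = TotalSpace.mk' ℂ x z := by
    rintro x y rfl
    exact ⟨LinearMap.id, fun z => rfl⟩
  obtain ⟨c, hc⟩ := cast _ _ h3
  have inj : Function.Injective (g.θ v b.1 h2 w₀) := by
    rw [injective_iff_map_eq_zero]
    intro u hu
    by_contra hne
    exact g.θ_ne_zero _ _ _ _ _ hw₀ hne hu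
  let f := LinearEquiv.ofInjectiveOfFinrankEq (g.θ v b.1 h2 w₀) inj (by rw [fr, fr])
  have hf : ∀ z, g.θ v b.1 h2 w₀ (f.symm z) = z := fun z => f.apply_symm_apply z
  refine ⟨f.symm.toLinearMap ∘ₗ c ∘ₗ (g.θ a.1 v h1).flip w₀, ?_, ?_⟩
  · intro u w
    obtain ⟨k, rfl⟩ := hspan w
    rw [← hc]
    congr 1
    simp [hf]
  · intro r hr
    ext u
    apply inj
    have := hr u w₀
    rw [← hc] at this
    have h5 := (TotalSpace.mk_inj).1 this
    simp [hf, h5]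

/-- The gluing map `ρ(a, v) : L_a → L_b` over an arrow `v : a ⟶ b` of the inertia groupoid, obtained
from `L_a ⊗ L_v ≅ L_{av} = L_{vb} ≅ L_v ⊗ L_b`: it is characterized by
`θ_{a,v}(u ⊗ w) = θ_{v,b}(w ⊗ ρ(a, v) u)`.  For trivial `L` this is multiplication by
`θ(a, v) / θ(v, v⁻¹ a v)`. -/
noncomputable def rho [VectorBundle ℂ ℂ L] (g : G.Gerbe L) (a b : G.Loop) (v : G₁)
    (hv : G.IsInertiaArrow a v b) : L a.1 →ₗ[ℂ] L b.1 :=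
  (g.exists_rho a b v hv).choose

end Gerbe

end OrbifoldGroupoid

/-!
The nonzero vectors of `L` form the arrows of a central extension of `G` by `ℂˣ`, in which `ρ` is
conjugation; this gives the functoriality of `ρ`. Since `G` is proper and étale, the order of its
isotropy groups is locally bounded, so some power `wⁿ` of a local frame `w` of `L` over loops is a
scalar `c ≠ 0`, and the smooth section `c^{-1/n} w` consists of torsion elements of bounded order.
The flat frames are the local frames of this kind: conjugation preserves torsion, and two torsion
vectors in one fibre differ by a root of unity of bounded order, which is locally constant as soon
as it is continuous.

Vectors over loops `γ₁, …, γₙ` with `γ₁ ⋯ γₙ = 1` have a scalar as their product, and this scalar is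
`n`-linear in the vectors and invariant under conjugation. The transfer to the center shows that in
a group whose center has finite index `k` the `k`-th power is a homomorphism, so a product of
torsion vectors of bounded order is again torsion of bounded order and the scalar is locally
constant in flat frames.
-/

section Algebra

theorem list_prod_pow_index_center_mul_eq_one {Γ : Type*} [Group Γ]
    [(Subgroup.center Γ).FiniteIndex] {m : ℕ} {l : List Γ} (hl : ∀ u ∈ l, u ^ m = 1) :
    l.prod ^ ((Subgroup.center Γ).index * m) = 1 := by
  have hmul (u v : Γ) : (u * v) ^ ((Subgroup.center Γ).index * m) =
      u ^ ((Subgroup.center Γ).index * m) * v ^ ((Subgroup.center Γ).index * m) := by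
    have hcomm : Commute (u ^ (Subgroup.center Γ).index) (v ^ (Subgroup.center Γ).index) :=
      (Subgroup.mem_center_iff.1 (MonoidHom.transferCenterPow Γ u).2 _).symm
    have hindex : (u * v) ^ (Subgroup.center Γ).index =
        u ^ (Subgroup.center Γ).index * v ^ (Subgroup.center Γ).index :=
      congrArg Subtype.val (map_mul (MonoidHom.transferCenterPow Γ) u v)
    rw [pow_mul, hindex, hcomm.mul_pow, ← pow_mul, ← pow_mul]
  let φ : Γ →* Γ := MonoidHom.mk' (fun u => u ^ ((Subgroup.center Γ).index * m)) hmul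
  have hker : l.prod ∈ φ.ker := Subgroup.list_prod_mem _ fun u hu => by
    rw [MonoidHom.mem_ker, MonoidHom.mk'_apply, mul_comm, pow_mul, hl u hu, one_pow]
  exact MonoidHom.mem_ker.1 hker

theorem list_prod_ofFn_smul {M A : Type*} [CommMonoid M] [Monoid A] [MulAction M A]
    [IsScalarTower M A A] [SMulCommClass M A A] {n : ℕ} (k : Fin n → M) (l : Fin n → A) :
    (List.ofFn fun i => k i • l i).prod = (∏ i, k i) • (List.ofFn l).prod := by
  induction n with
  | zero => simp
  | succ n ih =>
    simp only [List.ofFn_succ, List.prod_cons, Fin.prod_univ_succ, ih, smul_mul_smul_comm]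

theorem exists_multilinearMap_eq_of_homogeneous {K ι : Type*} [Field K] [Fintype ι] {V : ι → Type*}
    [∀ i, AddCommGroup (V i)] [∀ i, Module K (V i)] (hV : ∀ i, Module.finrank K (V i) = 1)
    (f : (∀ i, {u : V i // u ≠ 0}) → K)
    (hf : ∀ (k : ι → Kˣ) (u w : ∀ i, {u : V i // u ≠ 0}), (∀ i, (w i : V i) = k i • (u i : V i)) →
      f w = (∏ i, (k i : K)) * f u) :
    ∃ φ : MultilinearMap K V K, ∀ u : ∀ i, {u : V i // u ≠ 0}, φ (fun i => u i) = f u := by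
  have (i : ι) : FiniteDimensional K (V i) := FiniteDimensional.of_finrank_eq_succ (hV i)
  let e (i : ι) : V i ≃ₗ[K] K :=
    LinearEquiv.ofFinrankEq (V i) K ((hV i).trans (Module.finrank_self K).symm)
  let u₀ (i : ι) : {u : V i // u ≠ 0} := ⟨(e i).symm 1, by simp⟩
  refine ⟨f u₀ • (MultilinearMap.mkPiAlgebra K ι K).compLinearMap fun i => (e i).toLinearMap,
    fun u => ?_⟩
  have hu (i : ι) : (u i : V i) = e i (u i) • (u₀ i : V i) := by simp [u₀, ← map_smul]
  rw [hf (fun i => Units.mk0 (e i (u i)) (by simp [(u i).2])) u₀ u hu]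
  simp [mul_comm]

end Algebra

section Analysis

theorem eventually_eq_of_pow_eq_one {X K : Type*} [TopologicalSpace X] [Field K]
    [TopologicalSpace K] [T1Space K] {x₀ : X} {c : X → K} (hc : ContinuousAt c x₀) {m : ℕ}
    (hm : 0 < m) (h : ∀ᶠ x in 𝓝 x₀, c x ^ m = 1) : ∀ᶠ x in 𝓝 x₀, c x = c x₀ := by
  have hfin : {z : K | z ^ m = 1}.Finite :=
    (Polynomial.nthRootsFinset m (1 : K)).finite_toSet.subset fun z hz =>
      (Polynomial.mem_nthRootsFinset hm 1).2 hz
  have hclosed : IsClosed ({z : K | z ^ m = 1} \ {c x₀}) :=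
    (hfin.subset Set.sdiff_subset).isClosed
  filter_upwards [h, hc (hclosed.isOpen_compl.mem_nhds fun h => h.2 rfl)] with x hroot hx
  by_contra hne
  exact hx ⟨hroot, hne⟩

theorem exists_contDiffAt_pow_mul_eq_one {z₀ : ℂ} (hz₀ : z₀ ≠ 0) {n : ℕ} (hn : n ≠ 0) :
    ∃ h : ℂ → ℂ, (∀ z ≠ 0, h z ^ n * z = 1) ∧ ∀ᶠ z in 𝓝 z₀, ContDiffAt ℂ ∞ h z := by
  obtain ⟨r, hr⟩ := IsAlgClosed.exists_pow_nat_eq z₀⁻¹ (Nat.pos_of_ne_zero hn)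
  refine ⟨fun z => r * Complex.exp (-Complex.log (z / z₀) / n), fun z hz => ?_, ?_⟩
  · rw [mul_pow, hr, ← Complex.exp_nat_mul, mul_div_cancel₀ _ (Nat.cast_ne_zero.2 hn),
      Complex.exp_neg, Complex.exp_log (div_ne_zero hz hz₀)]
    field_simp
  · have hslit : ∀ᶠ z in 𝓝 z₀, z / z₀ ∈ Complex.slitPlane :=
      (continuous_id.div_const z₀).continuousAt
        (Complex.isOpen_slitPlane.mem_nhds (by simp [hz₀]))
    filter_upwards [hslit] with z hz
    have hlog : ContDiffAt ℂ ∞ (fun z => Complex.log (z / z₀)) z :=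
      (Complex.contDiffAt_log hz).comp z (contDiffAt_id.div_const z₀)
    exact contDiffAt_const.mul (hlog.neg.div_const _).cexp

theorem exists_eventually_encard_fiber_le {X Y : Type*} [TopologicalSpace X] [TopologicalSpace Y]
    {f : X → Y} (hf : IsProperMap f) (hinj : IsLocallyInjective f) (y₀ : Y) :
    ∃ N : ℕ, ∀ᶠ y in 𝓝 y₀, (f ⁻¹' {y}).encard ≤ N := by
  choose O hO hmem hinjOn using hinj
  obtain ⟨T, -, hT⟩ := (hf.isCompact_preimage (isCompact_singleton (x := y₀))).elim_nhds_subcover O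
    fun a _ => (hO a).mem_nhds (hmem a)
  have hcover : ∀ᶠ y in 𝓝 y₀, ∀ a ∈ f ⁻¹' {y}, a ∈ ⋃ i ∈ T, O i :=
    hf.isClosedMap.eventually_nhds_fiber y₀ fun a ha =>
      (isOpen_biUnion fun i _ => hO i).mem_nhds (hT ha)
  refine ⟨T.card, ?_⟩
  filter_upwards [hcover] with y hy
  choose! i hiT hi using fun a ha => Set.mem_iUnion₂.1 (hy a ha)
  rw [← Set.encard_coe_eq_coe_finsetCard]
  refine Set.encard_le_encard_of_injOn hiT fun a ha b hb hab => ?_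
  exact hinjOn (i a) (hi a ha) (hab ▸ hi b hb) (Eq.trans ha (Eq.symm hb))

end Analysis

namespace LineBundle

section Topological

variable {𝕜 B : Type*} [NontriviallyNormedField 𝕜] [TopologicalSpace B] {L : B → Type*}
  [∀ b, TopologicalSpace (L b)] [TopologicalSpace (TotalSpace 𝕜 L)] [FiberBundle 𝕜 L]

theorem eventually_mem_baseSet {X : Type*} [TopologicalSpace X] {x₀ : X} {f : X → B}
    (hf : ContinuousAt f x₀) : ∀ᶠ x in 𝓝 x₀, f x ∈ (trivializationAt 𝕜 L (f x₀)).baseSet :=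
  hf ((trivializationAt 𝕜 L (f x₀)).open_baseSet.mem_nhds (mem_baseSet_trivializationAt 𝕜 L _))

variable [∀ b, AddCommGroup (L b)] [∀ b, Module 𝕜 (L b)] [VectorBundle 𝕜 𝕜 L]

variable (𝕜 L) in
theorem finrank_fiber (b : B) : Module.finrank 𝕜 (L b) = 1 := by
  rw [((trivializationAt 𝕜 L b).linearEquivAt 𝕜 b (mem_baseSet_trivializationAt 𝕜 L b)).finrank_eq,
    Module.finrank_self]

variable (𝕜 L) in
include 𝕜 in
theorem exists_ne_zero (b : B) : ∃ u : L b, u ≠ 0 :=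
  (finrank_eq_one_iff'.1 (finrank_fiber 𝕜 L b)).imp fun _ h => h.1

variable (𝕜) in
theorem exists_smul_eq_of_ne_zero {b : B} {u : L b} (hu : u ≠ 0) (w : L b) :
    ∃ c : 𝕜, c • u = w :=
  (finrank_eq_one_iff_of_nonzero' u hu).1 (finrank_fiber 𝕜 L b) w

theorem trivializationAt_smul {a b : B} (hb : b ∈ (trivializationAt 𝕜 L a).baseSet) (c : 𝕜)
    (u : L b) :
    (trivializationAt 𝕜 L a ⟨b, c • u⟩).2 = c * (trivializationAt 𝕜 L a ⟨b, u⟩).2 :=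
  ((trivializationAt 𝕜 L a).linear 𝕜 hb).map_smul c u

theorem trivializationAt_ne_zero {a b : B} (hb : b ∈ (trivializationAt 𝕜 L a).baseSet) {u : L b}
    (hu : u ≠ 0) : (trivializationAt 𝕜 L a ⟨b, u⟩).2 ≠ 0 :=
  ((trivializationAt 𝕜 L a).linearEquivAt 𝕜 b hb).map_ne_zero_iff.2 hu

open Classical in
variable (𝕜 L) in
/-- The local frame with coordinate `1` in the preferred trivialization at `a`, extended by
arbitrary nonzero vectors outside the domain of this trivialization. -/
noncomputable def localFrame (a b : B) : L b :=
  if b ∈ (trivializationAt 𝕜 L a).baseSet then (trivializationAt 𝕜 L a).symm b 1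
  else (exists_ne_zero 𝕜 L b).choose

theorem trivializationAt_localFrame {a b : B} (hb : b ∈ (trivializationAt 𝕜 L a).baseSet) :
    (trivializationAt 𝕜 L a ⟨b, localFrame 𝕜 L a b⟩).2 = 1 := by
  rw [localFrame, if_pos hb, Trivialization.apply_mk_symm _ hb]

theorem localFrame_ne_zero (a b : B) : localFrame 𝕜 L a b ≠ 0 := by
  by_cases hb : b ∈ (trivializationAt 𝕜 L a).baseSet
  · rw [← ((trivializationAt 𝕜 L a).linearEquivAt 𝕜 b hb).map_ne_zero_iff]
    exact (trivializationAt_localFrame hb).trans_ne one_ne_zero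
  · rw [localFrame, if_neg hb]
    exact (exists_ne_zero 𝕜 L b).choose_spec

theorem trivializationAt_smul_localFrame {a b : B} (hb : b ∈ (trivializationAt 𝕜 L a).baseSet)
    (c : 𝕜) : (trivializationAt 𝕜 L a ⟨b, c • localFrame 𝕜 L a b⟩).2 = c := by
  rw [trivializationAt_smul hb, trivializationAt_localFrame hb, mul_one]

variable {X : Type*} [TopologicalSpace X] {x₀ : X}

theorem continuousAt_of_eventually_eq_smul {f h : X → TotalSpace 𝕜 L} {c : X → 𝕜}
    (hf : ContinuousAt f x₀) (hh : ContinuousAt h x₀) (hne : (h x₀).2 ≠ 0)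
    (heq : ∀ᶠ x in 𝓝 x₀, f x = ⟨(h x).1, c x • (h x).2⟩) : ContinuousAt c x₀ := by
  have hproj : (f x₀).1 = (h x₀).1 := by rw [heq.self_of_nhds]
  obtain ⟨hh₁, hh₂⟩ := (FiberBundle.continuousAt_totalSpace 𝕜 _).1 hh
  have hf₂ := ((FiberBundle.continuousAt_totalSpace 𝕜 _).1 hf).2
  rw [hproj] at hf₂
  have hne₂ := trivializationAt_ne_zero (mem_baseSet_trivializationAt 𝕜 L (h x₀).1) hne
  refine (hf₂.div hh₂ hne₂).congr ?_
  filter_upwards [heq, eventually_mem_baseSet (𝕜 := 𝕜) (L := L) hh₁, hh₂.eventually_ne hne₂]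
    with x hx hb hx_ne
  rw [Pi.div_apply, hx, trivializationAt_smul hb, mul_div_cancel_right₀ _ hx_ne]

theorem continuousAt_smul_localFrame {f : X → B} {c : X → 𝕜} (hf : ContinuousAt f x₀)
    (hc : ContinuousAt c x₀) :
    ContinuousAt (fun x => (⟨f x, c x • localFrame 𝕜 L (f x₀) (f x)⟩ : TotalSpace 𝕜 L)) x₀ := by
  refine (FiberBundle.continuousAt_totalSpace 𝕜 _).2 ⟨hf, hc.congr ?_⟩
  filter_upwards [eventually_mem_baseSet (𝕜 := 𝕜) (L := L) hf] with x hx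
  exact (trivializationAt_smul_localFrame hx (c x)).symm

theorem continuousAt_localFrame {f : X → B} (hf : ContinuousAt f x₀) :
    ContinuousAt (fun x => (⟨f x, localFrame 𝕜 L (f x₀) (f x)⟩ : TotalSpace 𝕜 L)) x₀ := by
  simpa only [one_smul] using continuousAt_smul_localFrame (L := L) hf
    (continuousAt_const (y := (1 : 𝕜)))

end Topological

section Smooth

variable {E H B : Type*} [NormedAddCommGroup E] [NormedSpace ℝ E] [TopologicalSpace H]
  [TopologicalSpace B] [ChartedSpace H B] {I : ModelWithCorners ℝ E H} {L : B → Type*}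
  [∀ b, AddCommGroup (L b)] [∀ b, Module ℂ (L b)] [∀ b, TopologicalSpace (L b)]
  [TopologicalSpace (TotalSpace ℂ L)] [FiberBundle ℂ L] [VectorBundle ℝ ℂ L]
  [ContMDiffVectorBundle ∞ ℂ L I]

theorem eventually_contMDiffAt_coordinate {F : B → TotalSpace ℂ L} {U : Set B} {b₀ : B}
    (hF : ContMDiffOn I (I.prod 𝓘(ℝ, ℂ)) ∞ F U) (hU : IsOpen U) (hb₀ : b₀ ∈ U) :
    ∀ᶠ b in 𝓝 b₀,
      ContMDiffAt I 𝓘(ℝ, ℂ) ∞ (fun x => (trivializationAt ℂ L (F b₀).1 (F x)).2) b := by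
  have hproj : ContinuousAt (fun b => (F b).1) b₀ :=
    (FiberBundle.continuous_proj ℂ L).continuousAt.comp
      (hF.continuousOn.continuousAt (hU.mem_nhds hb₀))
  filter_upwards [eventually_mem_baseSet (𝕜 := ℂ) (L := L) hproj, hU.mem_nhds hb₀] with b hb hbU
  exact (((trivializationAt ℂ L (F b₀).1).contMDiffAt_iff
    ((trivializationAt ℂ L (F b₀).1).mem_source.2 hb)).1 (hF.contMDiffAt (hU.mem_nhds hbU))).2

variable [VectorBundle ℂ ℂ L]

theorem contMDiffAt_smul_localFrame {a b : B} (hb : b ∈ (trivializationAt ℂ L a).baseSet)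
    {c : B → ℂ} (hc : ContMDiffAt I 𝓘(ℝ, ℂ) ∞ c b) :
    ContMDiffAt I (I.prod 𝓘(ℝ, ℂ)) ∞
      (fun x => TotalSpace.mk' ℂ x (c x • localFrame ℂ L a x)) b := by
  refine ((trivializationAt ℂ L a).contMDiffAt_section_iff hb).2 (hc.congr_of_eventuallyEq ?_)
  filter_upwards [(trivializationAt ℂ L a).open_baseSet.mem_nhds hb] with x hx
  exact trivializationAt_smul_localFrame hx (c x)

theorem contMDiffOn_localFrame (a : B) :
    ContMDiffOn I (I.prod 𝓘(ℝ, ℂ)) ∞ (fun x => TotalSpace.mk' ℂ x (localFrame ℂ L a x))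
      (trivializationAt ℂ L a).baseSet := fun b hb => by
  simpa only [one_smul] using (contMDiffAt_smul_localFrame hb
    (contMDiffAt_const (c := (1 : ℂ)))).contMDiffWithinAt

end Smooth

end LineBundle

section Smooth

variable {E H M E' H' N E'' H'' P : Type*}
  [NormedAddCommGroup E] [NormedSpace ℝ E] [TopologicalSpace H] [TopologicalSpace M]
  [ChartedSpace H M] [NormedAddCommGroup E'] [NormedSpace ℝ E'] [TopologicalSpace H']
  [TopologicalSpace N] [ChartedSpace H' N] [NormedAddCommGroup E''] [NormedSpace ℝ E'']
  [TopologicalSpace H''] [TopologicalSpace P] [ChartedSpace H'' P]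
  {I : ModelWithCorners ℝ E H} {J : ModelWithCorners ℝ E' H'} {K : ModelWithCorners ℝ E'' H''}
  {A : Set M}

theorem smoothOnSubset_of_contMDiffOn {U : Set M} {F : M → N} (hF : ContMDiffOn I J ∞ F U)
    (hU : IsOpen U) (hAU : A ⊆ U) : SmoothOnSubset I J A fun a => F a :=
  fun a => ⟨U, hU, hAU a.2, F, hF, fun _ _ => rfl⟩

namespace SmoothOnSubset

theorem continuous {f : A → N} (hf : SmoothOnSubset I J A f) : Continuous f := by
  refine continuous_iff_continuousAt.2 fun a => ?_
  obtain ⟨U, hU, haU, F, hF, hFf⟩ := hf a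
  have hFcont : ContinuousAt (fun b : A => F b) a :=
    (hF.continuousOn.continuousAt (hU.mem_nhds haU)).comp continuous_subtype_val.continuousAt
  refine hFcont.congr ?_
  filter_upwards [continuous_subtype_val.continuousAt (hU.mem_nhds haU)] with b hb
  exact hFf b hb

theorem comp {B : Set N} {k : B → P} {f : A → N} (hk : SmoothOnSubset J K B k)
    (hf : SmoothOnSubset I J A f) (h : ∀ a, f a ∈ B) :
    SmoothOnSubset I K A fun a => k ⟨f a, h a⟩ := fun a => by
  obtain ⟨U, hU, haU, F, hF, hFf⟩ := hf a
  obtain ⟨V, hV, haV, F', hF', hFk⟩ := hk ⟨f a, h a⟩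
  refine ⟨U ∩ F ⁻¹' V, hF.continuousOn.isOpen_inter_preimage hU hV,
    ⟨haU, by rwa [Set.mem_preimage, hFf a haU]⟩, F' ∘ F,
    hF'.comp (hF.mono Set.inter_subset_left) Set.inter_subset_right, fun b ⟨hbU, hbV⟩ => ?_⟩
  rw [Set.mem_preimage, hFf b hbU] at hbV
  rw [Function.comp_apply, hFf b hbU]
  exact hFk ⟨f b, h b⟩ hbV

theorem prodMk {f : A → N} {k : A → P} (hf : SmoothOnSubset I J A f)
    (hk : SmoothOnSubset I K A k) : SmoothOnSubset I (J.prod K) A fun a => (f a, k a) := fun a => by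
  obtain ⟨U, hU, haU, F, hF, hFf⟩ := hf a
  obtain ⟨V, hV, haV, F', hF', hFk⟩ := hk a
  exact ⟨U ∩ V, hU.inter hV, ⟨haU, haV⟩, fun x => (F x, F' x),
    (hF.mono Set.inter_subset_left).prodMk (hF'.mono Set.inter_subset_right),
    fun b hb => Prod.ext (hFf b hb.1) (hFk b hb.2)⟩

end SmoothOnSubset

end Smooth

namespace OrbifoldGroupoid

variable {E G₀ G₁ : Type*} [NormedAddCommGroup E] [NormedSpace ℝ E]
  [TopologicalSpace G₀] [ChartedSpace E G₀] [TopologicalSpace G₁] [ChartedSpace E G₁]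
  (G : OrbifoldGroupoid E G₀ G₁)

theorem e_mul_of_eq {x : G₀} {a : G₁} (hx : G.s a = x) (h : G.t (G.e x) = G.s a) :
    G.mul (G.e x) a h = a := by
  subst hx
  exact G.e_mul a

theorem mul_e_of_eq {x : G₀} {a : G₁} (hx : G.t a = x) (h : G.t a = G.s (G.e x)) :
    G.mul a (G.e x) h = a := by
  subst hx
  exact G.mul_e a

theorem continuous_s : Continuous G.s :=
  G.s_etale.isLocalHomeomorph.continuous

theorem continuous_e : Continuous G.e :=
  G.e_smooth.continuous

theorem eventually_eq_e (x : G₀) : ∀ᶠ a in 𝓝 (G.e x), a = G.e (G.s a) := by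
  obtain ⟨U, hU, hxU, hinj⟩ := G.s_etale.isLocalHomeomorph.isLocallyInjective (G.e x)
  have he : ∀ᶠ a in 𝓝 (G.e x), G.e (G.s a) ∈ U :=
    (G.continuous_e.comp G.continuous_s).continuousAt (hU.mem_nhds (by simpa [G.s_e] using hxU))
  filter_upwards [hU.mem_nhds hxU, he] with a ha hea
  exact hinj ha hea (G.s_e _).symm

/-- The isotropy group at `x`, as a set of arrows. -/
def isotropy (x : G₀) : Set G₁ :=
  {a | G.s a = x ∧ G.t a = x}

theorem exists_eventually_encard_isotropy_le (x₀ : G₀) :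
    ∃ N : ℕ, ∀ᶠ x in 𝓝 x₀, (G.isotropy x).encard ≤ N := by
  have hinj : IsLocallyInjective fun a => (G.s a, G.t a) := fun a => by
    obtain ⟨U, hU, haU, hs⟩ := G.s_etale.isLocalHomeomorph.isLocallyInjective a
    exact ⟨U, hU, haU, fun b hb c hc h => hs hb hc (congrArg Prod.fst h)⟩
  obtain ⟨N, hN⟩ := exists_eventually_encard_fiber_le G.proper hinj (x₀, x₀)
  refine ⟨N, ((continuous_id.prodMk continuous_id).tendsto x₀).eventually hN |>.mono ?_⟩
  intro x hx
  convert hx using 2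
  ext a
  simp [isotropy]

variable {G}

theorem mul_congr {a a' b b' : G₁} (ha : a = a') (hb : b = b') (h : G.t a = G.s b)
    (h' : G.t a' = G.s b') : G.mul a b h = G.mul a' b' h' := by
  subst ha hb
  rfl

theorem IsInertiaArrow.s_eq {a b : G.Loop} {v : G₁} (hv : G.IsInertiaArrow a v b) :
    G.s v = G.s a.1 :=
  hv.choose.symm.trans a.2.symm

theorem IsInertiaArrow.t_eq {a b : G.Loop} {v : G₁} (hv : G.IsInertiaArrow a v b) :
    G.t v = G.s b.1 :=
  hv.choose_spec.choose

theorem inv_mul_cancel_left {a b : G₁} (h : G.t a = G.s b)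
    (h' : G.t (G.inv a) = G.s (G.mul a b h)) : G.mul (G.inv a) (G.mul a b h) h' = b := by
  rw [← G.mul_assoc (G.inv a) a b (G.t_inv a) h,
    mul_congr (G.inv_mul a) rfl _ ((G.t_e _).trans h), G.e_mul_of_eq h.symm]

theorem mul_inv_cancel_right {a b : G₁} (h : G.t a = G.s b)
    (h' : G.t (G.mul a b h) = G.s (G.inv b)) : G.mul (G.mul a b h) (G.inv b) h' = a := by
  rw [G.mul_assoc a b (G.inv b) h (G.s_inv b).symm,
    mul_congr rfl (G.mul_inv b) _ (h.trans (G.s_e _).symm), G.mul_e_of_eq h]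

theorem mul_inv_eq_inv_mul {v v' y z : G₁} {h : G.t v = G.s y} {h' : G.t z = G.s v'}
    (heq : G.mul v y h = G.mul z v' h') (hy : G.t y = G.s (G.inv v'))
    (hz : G.t (G.inv v) = G.s z) : G.mul y (G.inv v') hy = G.mul (G.inv v) z hz := by
  have hvy : G.t (G.inv v) = G.s (G.mul v y h) := by rw [G.t_inv, G.s_mul]
  have hzv : G.t (G.mul z v' h') = G.s (G.inv v') := by rw [G.t_mul, G.s_inv]
  calc G.mul y (G.inv v') hy
      = G.mul (G.mul (G.inv v) (G.mul v y h) hvy) (G.inv v')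
          ((G.t_mul _ _ _).trans ((G.t_mul _ _ _).trans hy)) :=
        mul_congr (G.inv_mul_cancel_left h _).symm rfl _ _
    _ = G.mul (G.inv v) (G.mul (G.mul v y h) (G.inv v') ((G.t_mul _ _ _).trans hy)) _ :=
        G.mul_assoc ..
    _ = G.mul (G.inv v) z hz :=
        mul_congr rfl ((mul_congr heq rfl _ hzv).trans (G.mul_inv_cancel_right h' _)) _ _

theorem IsInertiaArrow.inv {a b : G.Loop} {v : G₁} (hv : G.IsInertiaArrow a v b) :
    G.IsInertiaArrow b (G.inv v) a := by
  obtain ⟨hav, hvb, heq⟩ := hv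
  have hb : G.t b.1 = G.s (G.inv v) := by rw [G.s_inv, hvb, b.2]
  have ha : G.t (G.inv v) = G.s a.1 := by rw [G.t_inv, ← hav, a.2]
  exact ⟨hb, ha, mul_inv_eq_inv_mul heq.symm hb ha⟩

theorem HasUnitProduct.exists_base {n : ℕ} {γ : Fin n → G.Loop} (h : G.HasUnitProduct γ) :
    ∃ x, (∀ i, G.s (γ i).1 = x) ∧ ∃ p : Fin (n + 1) → G₁, p 0 = G.e x ∧
      p (Fin.last n) = G.e x ∧ ∀ i : Fin n, ∃ h : G.t (p i.castSucc) = G.s (γ i).1,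
        p i.succ = G.mul (p i.castSucc) (γ i).1 h := by
  obtain ⟨x, p, h0, hlast, hp⟩ := h
  have ht (j : Fin (n + 1)) : G.t (p j) = x := by
    induction j using Fin.induction with
    | zero => rw [h0, G.t_e]
    | succ i ih =>
      obtain ⟨h, hi⟩ := hp i
      rw [hi, G.t_mul, ← (γ i).2, ← h, ih]
  exact ⟨x, fun i => (hp i).choose.symm.trans (ht _), p, h0, hlast, hp⟩

theorem HasUnitProduct.s_eq {n : ℕ} {γ : Fin n → G.Loop} (h : G.HasUnitProduct γ) (i j : Fin n) :
    G.s (γ i).1 = G.s (γ j).1 := by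
  obtain ⟨x, hx, -⟩ := h.exists_base
  rw [hx i, hx j]

end OrbifoldGroupoid

namespace OrbifoldGroupoid.Gerbe

variable {E G₀ G₁ : Type*} [NormedAddCommGroup E] [NormedSpace ℝ E]
  [TopologicalSpace G₀] [ChartedSpace E G₀] [TopologicalSpace G₁] [ChartedSpace E G₁]
  {G : OrbifoldGroupoid E G₀ G₁} {L : G₁ → Type*}
  [∀ a, AddCommGroup (L a)] [∀ a, Module ℂ (L a)] [∀ a, TopologicalSpace (L a)]
  [TopologicalSpace (TotalSpace ℂ L)] [FiberBundle ℂ L]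

/-- The product `θ_{a,b}(u ⊗ w)` of vectors `u ∈ L_a` and `w ∈ L_b` over composable arrows, as a
point of the total space. -/
def prod (g : G.Gerbe L) (p q : TotalSpace ℂ L) (h : G.t p.1 = G.s q.1) : TotalSpace ℂ L :=
  ⟨G.mul p.1 q.1 h, g.θ p.1 q.1 h p.2 q.2⟩

/-- The arrows from `x` to `y` in the central extension of `G` by `ℂˣ` defined by the gerbe `g`:
the nonzero vectors of `L` over the arrows of `G` from `x` to `y`. -/
@[ext]
structure Arrow (g : G.Gerbe L) (x y : G₀) where
  vec : TotalSpace ℂ L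
  vec_ne_zero : vec.2 ≠ 0
  s_proj : G.s vec.1 = x
  t_proj : G.t vec.1 = y

namespace Arrow

variable {g : G.Gerbe L} {x y z : G₀}

instance : MulAction ℂˣ (g.Arrow x y) where
  smul c p := ⟨⟨p.vec.1, (c : ℂ) • p.vec.2⟩, smul_ne_zero c.ne_zero p.vec_ne_zero, p.s_proj,
    p.t_proj⟩
  one_smul p := Arrow.ext (congrArg (TotalSpace.mk' ℂ p.vec.1) (one_smul ℂ p.vec.2))
  mul_smul c d p := Arrow.ext
    (congrArg (TotalSpace.mk' ℂ p.vec.1) (mul_smul (c : ℂ) (d : ℂ) p.vec.2))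

theorem smul_left_cancel {c d : ℂˣ} {p : g.Arrow x y} (h : c • p = d • p) : c = d :=
  Units.ext (smul_left_injective ℂ p.vec_ne_zero (TotalSpace.mk_inj.1 (congrArg Arrow.vec h)))

/-- Composition in the central extension. -/
def comp (p : g.Arrow x y) (q : g.Arrow y z) : g.Arrow x z where
  vec := g.prod p.vec q.vec (p.t_proj.trans q.s_proj.symm)
  vec_ne_zero := g.θ_ne_zero _ _ _ _ _ p.vec_ne_zero q.vec_ne_zero
  s_proj := (G.s_mul _ _ _).trans p.s_proj
  t_proj := (G.t_mul _ _ _).trans q.t_proj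

theorem comp_assoc {w : G₀} (p : g.Arrow w x) (q : g.Arrow x y) (r : g.Arrow y z) :
    (p.comp q).comp r = p.comp (q.comp r) :=
  Arrow.ext (g.cocycle ..)

theorem smul_comp (c : ℂˣ) (p : g.Arrow x y) (q : g.Arrow y z) :
    (c • p).comp q = c • p.comp q :=
  Arrow.ext (congrArg (TotalSpace.mk' ℂ _) (LinearMap.map_smul₂ (g.θ ..) (c : ℂ) p.vec.2 q.vec.2))

theorem comp_smul (c : ℂˣ) (p : g.Arrow x y) (q : g.Arrow y z) :
    p.comp (c • q) = c • p.comp q :=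
  Arrow.ext (congrArg (TotalSpace.mk' ℂ _) (map_smul (g.θ _ _ _ p.vec.2) (c : ℂ) q.vec.2))

variable [VectorBundle ℂ ℂ L]

theorem exists_smul_eq {p q : g.Arrow x y} (h : p.vec.1 = q.vec.1) : ∃ c : ℂˣ, c • p = q := by
  obtain ⟨⟨a, u⟩, hu, hp⟩ := p
  obtain ⟨⟨b, w⟩, hw, hq⟩ := q
  obtain rfl : a = b := h
  obtain ⟨c, rfl⟩ := LineBundle.exists_smul_eq_of_ne_zero ℂ hu w
  exact ⟨Units.mk0 c (left_ne_zero_of_smul hw), rfl⟩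

theorem exists_vec_proj_eq (g : G.Gerbe L) {v : G₁} (hs : G.s v = x) (ht : G.t v = y) :
    ∃ w : g.Arrow x y, w.vec.1 = v := by
  obtain ⟨u, hu⟩ := LineBundle.exists_ne_zero ℂ L v
  exact ⟨⟨⟨v, u⟩, hu, hs, ht⟩, rfl⟩

variable (g x) in
theorem exists_idempotent : ∃ p : g.Arrow x x, p.vec.1 = G.e x ∧ p.comp p = p := by
  obtain ⟨p, hp⟩ := exists_vec_proj_eq g (G.s_e x) (G.t_e x)
  have hpp : (p.comp p).vec.1 = p.vec.1 :=
    (mul_congr hp rfl _ ((G.t_e _).trans p.s_proj.symm)).trans (G.e_mul_of_eq p.s_proj _)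
  obtain ⟨c, hc⟩ := exists_smul_eq hpp
  exact ⟨c • p, hp, by rw [smul_comp, comp_smul, hc]⟩

variable (g x) in
/-- The identity of `x`: the idempotent vector over the unit arrow. -/
noncomputable def id : g.Arrow x x :=
  (exists_idempotent g x).choose

theorem id_vec_proj : (id g x).vec.1 = G.e x :=
  (exists_idempotent g x).choose_spec.1

theorem id_comp_id : (id g x).comp (id g x) = id g x :=
  (exists_idempotent g x).choose_spec.2

theorem id_comp (p : g.Arrow x y) : (id g x).comp p = p := by
  have hproj : p.vec.1 = ((id g x).comp p).vec.1 :=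
    ((mul_congr id_vec_proj rfl _ ((G.t_e _).trans p.s_proj.symm)).trans
      (G.e_mul_of_eq p.s_proj _)).symm
  obtain ⟨c, hc⟩ := exists_smul_eq hproj
  have hassoc := comp_assoc (id g x) (id g x) p
  rw [id_comp_id, ← hc, comp_smul, ← hc, smul_smul] at hassoc
  rw [← hc, left_eq_mul.1 (smul_left_cancel hassoc), one_smul]

theorem comp_id (p : g.Arrow x y) : p.comp (id g y) = p := by
  have hproj : p.vec.1 = (p.comp (id g y)).vec.1 :=
    ((mul_congr rfl id_vec_proj _ (p.t_proj.trans (G.s_e _).symm)).trans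
      (G.mul_e_of_eq p.t_proj _)).symm
  obtain ⟨c, hc⟩ := exists_smul_eq hproj
  have hassoc := comp_assoc p (id g y) (id g y)
  rw [id_comp_id, ← hc, smul_comp, ← hc, smul_smul] at hassoc
  rw [← hc, mul_eq_right.1 (smul_left_cancel hassoc), one_smul]

theorem exists_comp_eq_id (p : g.Arrow x y) : ∃ q : g.Arrow y x, p.comp q = id g x := by
  obtain ⟨q, hq⟩ := exists_vec_proj_eq g ((G.s_inv p.vec.1).trans p.t_proj)
    ((G.t_inv p.vec.1).trans p.s_proj)
  have hproj : (p.comp q).vec.1 = (id g x).vec.1 :=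
    calc (p.comp q).vec.1 = G.e (G.s p.vec.1) :=
          (mul_congr rfl hq _ (G.s_inv _).symm).trans (G.mul_inv _)
      _ = (id g x).vec.1 := by rw [p.s_proj, id_vec_proj]
  obtain ⟨c, hc⟩ := exists_smul_eq hproj
  exact ⟨c • q, by rw [comp_smul, hc]⟩

/-- The inverse in the central extension. -/
noncomputable def inv (p : g.Arrow x y) : g.Arrow y x :=
  p.exists_comp_eq_id.choose

theorem comp_inv (p : g.Arrow x y) : p.comp p.inv = id g x :=
  p.exists_comp_eq_id.choose_spec

theorem inv_comp (p : g.Arrow x y) : p.inv.comp p = id g y := by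
  calc p.inv.comp p = (p.inv.comp p).comp (p.inv.comp p.inv.inv) := by rw [comp_inv, comp_id]
    _ = p.inv.comp ((p.comp p.inv).comp p.inv.inv) := by simp only [comp_assoc]
    _ = id g y := by rw [comp_inv, id_comp, comp_inv]

noncomputable instance : Group (g.Arrow x x) where
  mul := comp
  one := id g x
  inv := inv
  mul_assoc := comp_assoc
  one_mul := id_comp
  mul_one := comp_id
  inv_mul_cancel := inv_comp

theorem mul_eq_comp (p q : g.Arrow x x) : p * q = p.comp q :=
  rfl

theorem one_eq_id : (1 : g.Arrow x x) = id g x :=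
  rfl

instance : IsScalarTower ℂˣ (g.Arrow x x) (g.Arrow x x) :=
  ⟨smul_comp⟩

instance : SMulCommClass ℂˣ (g.Arrow x x) (g.Arrow x x) :=
  ⟨fun c p q => (comp_smul c p q).symm⟩

variable (g x) in
/-- The kernel `ℂˣ` of the projection from the isotropy group at `x` of the central extension to
the isotropy group of `G`. -/
noncomputable def scalars : Subgroup (g.Arrow x x) :=
  (MonoidHom.smulOneHom : ℂˣ →* g.Arrow x x).range

theorem mem_scalars_iff {p : g.Arrow x x} : p ∈ scalars g x ↔ p.vec.1 = G.e x := by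
  refine ⟨?_, fun h => exists_smul_eq (id_vec_proj.trans h.symm)⟩
  rintro ⟨c, rfl⟩
  exact id_vec_proj

theorem scalars_le_center : scalars g x ≤ Subgroup.center (g.Arrow x x) := by
  rintro _ ⟨c, rfl⟩
  refine Subgroup.mem_center_iff.2 fun p => ?_
  rw [MonoidHom.smulOneHom_apply, mul_smul_comm, mul_one, smul_one_mul]

theorem inv_mul_mem_scalars {p q : g.Arrow x x} (h : p.vec.1 = q.vec.1) :
    p⁻¹ * q ∈ scalars g x := by
  obtain ⟨c, rfl⟩ := exists_smul_eq h
  exact ⟨c, by rw [mul_smul_comm, inv_mul_cancel, MonoidHom.smulOneHom_apply]⟩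

theorem finiteIndex_scalars_and_index_le {N : ℕ} (hN : (G.isotropy x).encard ≤ N) :
    (scalars g x).FiniteIndex ∧ (scalars g x).index ≤ N := by
  have hfin : (G.isotropy x).Finite := Set.finite_of_encard_le_coe hN
  have : Finite (G.isotropy x) := hfin
  let proj (c : g.Arrow x x ⧸ scalars g x) : G.isotropy x :=
    ⟨c.out.vec.1, c.out.s_proj, c.out.t_proj⟩
  have hproj : Function.Injective proj := fun c d h => by
    rw [← c.out_eq, ← d.out_eq]
    exact QuotientGroup.eq.2 (inv_mul_mem_scalars (congrArg Subtype.val h))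
  have := Finite.of_injective proj hproj
  refine ⟨Subgroup.finiteIndex_of_finite_quotient, ?_⟩
  calc (scalars g x).index ≤ Nat.card (G.isotropy x) := Nat.card_le_card_of_injective proj hproj
    _ ≤ N := by rwa [← Nat.cast_le (α := ℕ∞), Nat.card_coe_set_eq, hfin.cast_ncard_eq]

theorem list_prod_pow_factorial_mul_eq_one {N m : ℕ} (hN : (G.isotropy x).encard ≤ N)
    {l : List (g.Arrow x x)} (hl : ∀ u ∈ l, u ^ m = 1) : l.prod ^ (N.factorial * m) = 1 := by
  obtain ⟨_, hle⟩ := finiteIndex_scalars_and_index_le (g := g) hN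
  have := Subgroup.finiteIndex_of_le (scalars_le_center (g := g) (x := x))
  have hdvd : (Subgroup.center (g.Arrow x x)).index ∣ N.factorial :=
    (Subgroup.index_dvd_of_le scalars_le_center).trans
      (Nat.dvd_factorial (Nat.pos_of_ne_zero Subgroup.FiniteIndex.index_ne_zero) hle)
  obtain ⟨k, hk⟩ := mul_dvd_mul_right hdvd m
  rw [hk, pow_mul, list_prod_pow_index_center_mul_eq_one hl, one_pow]

/-- Conjugation `u ↦ w⁻¹ u w` by an arrow of the central extension. -/
noncomputable def conj (w : g.Arrow x y) : g.Arrow x x →* g.Arrow y y where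
  toFun u := (w.inv.comp u).comp w
  map_one' := by rw [one_eq_id, comp_id, inv_comp, one_eq_id]
  map_mul' u v := by
    calc (w.inv.comp (u.comp v)).comp w
        = (w.inv.comp (u.comp ((id g x).comp v))).comp w := by rw [id_comp]
      _ = _ := by simp only [← comp_inv w, mul_eq_comp, comp_assoc]

theorem conj_apply (w : g.Arrow x y) (u : g.Arrow x x) : conj w u = (w.inv.comp u).comp w :=
  rfl

theorem eq_conj_iff {w : g.Arrow x y} {u : g.Arrow x x} {u' : g.Arrow y y} :
    u' = conj w u ↔ w.comp u' = u.comp w := by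
  rw [conj_apply]
  constructor
  · rintro rfl
    rw [← comp_assoc, ← comp_assoc, comp_inv, id_comp]
  · intro h
    rw [comp_assoc, ← h, ← comp_assoc, inv_comp, id_comp]

theorem conj_id (u : g.Arrow x x) : conj (id g x) u = u :=
  (eq_conj_iff.2 (by rw [id_comp, comp_id])).symm

theorem conj_comp (w : g.Arrow x y) (w' : g.Arrow y z) (u : g.Arrow x x) :
    conj (w.comp w') u = conj w' (conj w u) := by
  refine (eq_conj_iff.2 ?_).symm
  rw [comp_assoc, eq_conj_iff.1 rfl, ← comp_assoc, eq_conj_iff.1 rfl, comp_assoc]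

theorem conj_smul (w : g.Arrow x y) (c : ℂˣ) (u : g.Arrow x x) : conj w (c • u) = c • conj w u := by
  rw [conj_apply, comp_smul, smul_comp, conj_apply]

end Arrow

/-- A nonzero vector over a loop at `x`, as an element of the isotropy group at `x` of the central
extension. -/
def loop (g : G.Gerbe L) {x : G₀} {a : G.Loop} (ha : G.s a.1 = x) {u : L a.1} (hu : u ≠ 0) :
    g.Arrow x x :=
  ⟨⟨a.1, u⟩, hu, ha, a.2.symm.trans ha⟩

variable {g : G.Gerbe L} {x y : G₀} {a b : G.Loop} {v : G₁}

theorem loop_congr (ha : G.s a.1 = x) {u u' : L a.1} (h : u = u') (hu : u ≠ 0) (hu' : u' ≠ 0) :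
    g.loop ha hu = g.loop ha hu' := by
  subst h
  rfl

theorem loop_injective (ha : G.s a.1 = x) {u u' : L a.1} {hu : u ≠ 0} {hu' : u' ≠ 0}
    (h : g.loop ha hu = g.loop ha hu') : u = u' :=
  TotalSpace.mk_inj.1 (congrArg Arrow.vec h)

theorem loop_smul (ha : G.s a.1 = x) {u : L a.1} (hu : u ≠ 0) (c : ℂˣ) :
    g.loop ha (smul_ne_zero c.ne_zero hu) = c • g.loop ha hu :=
  rfl

theorem continuousAt_prod {X : Type*} [TopologicalSpace X] {x₀ : X} {p q : X → TotalSpace ℂ L}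
    (hp : ContinuousAt p x₀) (hq : ContinuousAt q x₀) (h : ∀ x, G.t (p x).1 = G.s (q x).1) :
    ContinuousAt (fun x => g.prod (p x) (q x) (h x)) x₀ := by
  have hpq : ContinuousAt (fun x => (⟨(p x, q x), h x⟩ :
      {p : TotalSpace ℂ L × TotalSpace ℂ L | G.t p.1.1 = G.s p.2.1})) x₀ :=
    (hp.prodMk hq).codRestrict h
  exact g.smooth.continuous.continuousAt.comp hpq

variable [VectorBundle ℂ ℂ L]

theorem rho_spec (hv : G.IsInertiaArrow a v b) (u : L a.1) (w : L v) :
    g.prod ⟨a.1, u⟩ ⟨v, w⟩ hv.choose =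
      g.prod ⟨v, w⟩ ⟨b.1, g.rho a b v hv u⟩ hv.choose_spec.choose :=
  (g.exists_rho a b v hv).choose_spec.1 u w

theorem rho_ne_zero (hv : G.IsInertiaArrow a v b) {u : L a.1} (hu : u ≠ 0) :
    g.rho a b v hv u ≠ 0 := by
  intro hzero
  obtain ⟨w, hw⟩ := LineBundle.exists_ne_zero ℂ L v
  have hprod : (g.prod ⟨a.1, u⟩ ⟨v, w⟩ hv.choose).2 = 0 := by
    rw [rho_spec hv, hzero]
    exact map_zero _
  exact g.θ_ne_zero _ _ _ _ _ hu hw hprod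

theorem loop_rho (hv : G.IsInertiaArrow a v b) (ha : G.s a.1 = x) (hb : G.s b.1 = y) {u : L a.1}
    (hu : u ≠ 0) {w : g.Arrow x y} (hw : w.vec.1 = v) :
    g.loop hb (rho_ne_zero (g := g) hv hu) = Arrow.conj w (g.loop ha hu) := by
  obtain ⟨⟨v, w⟩, hw₀, hs, ht⟩ := w
  obtain rfl : v = _ := hw
  exact Arrow.eq_conj_iff.2 (Arrow.ext (rho_spec hv u w).symm)

variable (g) in
theorem rho_id (a : G.Loop) (u : L a.1) :
    g.rho a a (G.e (G.s a.1)) (G.isInertiaArrow_id a) u = u := by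
  rcases eq_or_ne u 0 with rfl | hu
  · exact map_zero _
  · refine loop_injective (g := g) rfl (hu := rho_ne_zero _ hu) (hu' := hu) ?_
    rw [loop_rho _ rfl rfl hu Arrow.id_vec_proj, Arrow.conj_id]

theorem rho_comp {c : G.Loop} {w : G₁} (hv : G.IsInertiaArrow a v b) (hw : G.IsInertiaArrow b w c)
    (h : G.t v = G.s w) (u : L a.1) :
    g.rho a c (G.mul v w h) (hv.comp hw h) u = g.rho b c w hw (g.rho a b v hv u) := by
  rcases eq_or_ne u 0 with rfl | hu
  · simp only [map_zero]
  · obtain ⟨p, hp⟩ := Arrow.exists_vec_proj_eq g hv.s_eq hv.t_eq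
    obtain ⟨q, hq⟩ := Arrow.exists_vec_proj_eq g hw.s_eq hw.t_eq
    refine loop_injective (g := g) rfl (hu := rho_ne_zero _ hu)
      (hu' := rho_ne_zero hw (rho_ne_zero hv hu)) ?_
    rw [loop_rho _ rfl rfl hu (w := p.comp q) (mul_congr hp hq _ _), Arrow.conj_comp,
      loop_rho hw rfl rfl (rho_ne_zero hv hu) hq, loop_rho hv rfl rfl hu hp]

/-- A vector over a loop is `n`-torsion when its `n`-th power in the central extension is the
identity. -/
def IsTorsion (g : G.Gerbe L) (n : ℕ) {a : G.Loop} (u : L a.1) : Prop :=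
  ∃ hu : u ≠ 0, g.loop rfl hu ^ n = 1

theorem IsTorsion.loop_pow_eq_one {n : ℕ} {u : L a.1} (h : g.IsTorsion n u) (ha : G.s a.1 = x) :
    g.loop ha h.1 ^ n = 1 := by
  subst ha
  exact h.2

theorem IsTorsion.rho {n : ℕ} {u : L a.1} (h : g.IsTorsion n u) (hv : G.IsInertiaArrow a v b) :
    g.IsTorsion n (g.rho a b v hv u) := by
  obtain ⟨p, hp⟩ := Arrow.exists_vec_proj_eq g hv.s_eq hv.t_eq
  refine ⟨rho_ne_zero hv h.1, ?_⟩
  rw [loop_rho hv rfl rfl h.1 hp, ← map_pow, h.2, map_one]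

theorem IsTorsion.pow_mul_eq_one {m n : ℕ} {c : ℂ} {u u' : L a.1} (h : g.IsTorsion m u)
    (h' : g.IsTorsion n u') (hc : u' = c • u) : c ^ (m * n) = 1 := by
  have hc₀ : c ≠ 0 := left_ne_zero_of_smul (hc ▸ h'.1)
  lift c to ℂˣ using hc₀.isUnit
  have hloop : g.loop rfl h'.1 = c • g.loop rfl h.1 :=
    (loop_congr rfl hc _ _).trans (loop_smul rfl h.1 c)
  have hpow : (c ^ (m * n)) • (1 : g.Arrow (G.s a.1) (G.s a.1)) = (1 : ℂˣ) • 1 := by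
    calc (c ^ (m * n)) • (1 : g.Arrow (G.s a.1) (G.s a.1))
        = (c ^ (m * n)) • g.loop rfl h.1 ^ (m * n) := by rw [pow_mul (g.loop rfl h.1), h.2, one_pow]
      _ = (1 : ℂˣ) • 1 := by
        rw [← smul_pow, ← hloop, mul_comm, pow_mul, h'.2, one_pow, one_smul]
  exact congrArg Units.val (Arrow.smul_left_cancel hpow)

section Continuity

variable {X : Type*} [TopologicalSpace X] {x₀ : X}

theorem continuousAt_of_prod_left {p q : X → TotalSpace ℂ L} (h : ∀ x, G.t (p x).1 = G.s (q x).1)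
    (hp : ContinuousAt p x₀) (hp₀ : (p x₀).2 ≠ 0) (hq : ContinuousAt (fun x => (q x).1) x₀)
    (hpq : ContinuousAt (fun x => g.prod (p x) (q x) (h x)) x₀) : ContinuousAt q x₀ := by
  have hframe := LineBundle.continuousAt_localFrame (𝕜 := ℂ) (L := L) hq
  choose c hc using fun x =>
    LineBundle.exists_smul_eq_of_ne_zero ℂ (LineBundle.localFrame_ne_zero (𝕜 := ℂ) (L := L)
      (q x₀).1 (q x).1) (q x).2
  have hcont : ContinuousAt c x₀ := by
    refine LineBundle.continuousAt_of_eventually_eq_smul hpq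
      (continuousAt_prod (g := g) hp hframe h)
      (g.θ_ne_zero _ _ _ _ _ hp₀ (LineBundle.localFrame_ne_zero _ _)) (.of_forall fun x => ?_)
    exact congrArg (TotalSpace.mk' ℂ _) ((congrArg _ (hc x).symm).trans (map_smul _ _ _))
  exact (LineBundle.continuousAt_smul_localFrame hq hcont).congr
    (.of_forall fun x => congrArg (TotalSpace.mk' ℂ (q x).1) (hc x))

theorem exists_continuousAt_ne_zero {v : X → G₁} (hv : ContinuousAt v x₀) :
    ∃ w : ∀ x, L (v x), (∀ x, w x ≠ 0) ∧
      ContinuousAt (fun x => (⟨v x, w x⟩ : TotalSpace ℂ L)) x₀ :=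
  ⟨fun x => LineBundle.localFrame ℂ L (v x₀) (v x), fun _ => LineBundle.localFrame_ne_zero _ _,
    LineBundle.continuousAt_localFrame hv⟩

theorem continuousAt_id_vec {f : X → G₀} (hf : ContinuousAt f x₀) :
    ContinuousAt (fun x => (Arrow.id g (f x)).vec) x₀ := by
  have he : ContinuousAt (fun x => G.e (f x)) x₀ := G.continuous_e.continuousAt.comp hf
  obtain ⟨w, hw, hwcont⟩ := exists_continuousAt_ne_zero (L := L) he
  refine continuousAt_of_prod_left (g := g) (p := fun x => ⟨G.e (f x), w x⟩)
    (fun x => (G.t_e _).trans (Arrow.id g (f x)).s_proj.symm) hwcont (hw x₀) ?_ ?_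
  · exact he.congr (.of_forall fun x => Arrow.id_vec_proj.symm)
  · exact hwcont.congr (.of_forall fun x => (congrArg Arrow.vec
      (Arrow.comp_id (g := g) ⟨⟨_, w x⟩, hw x, G.s_e _, G.t_e _⟩)).symm)

theorem continuousAt_rho {a b : X → G.Loop} {v : X → G₁} {u : ∀ x, L (a x).1}
    (hb : ContinuousAt b x₀) (hv : ContinuousAt v x₀)
    (hu : ContinuousAt (fun x => (⟨(a x).1, u x⟩ : TotalSpace ℂ L)) x₀)
    (h : ∀ x, G.IsInertiaArrow (a x) (v x) (b x)) :
    ContinuousAt (fun x => (⟨(b x).1, g.rho (a x) (b x) (v x) (h x) (u x)⟩ : TotalSpace ℂ L))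
      x₀ := by
  obtain ⟨w, hw, hwcont⟩ := exists_continuousAt_ne_zero (L := L) hv
  refine continuousAt_of_prod_left (g := g) (p := fun x => ⟨v x, w x⟩)
    (fun x => (h x).choose_spec.choose) hwcont (hw x₀) (continuous_subtype_val.continuousAt.comp hb)
    ?_
  exact (continuousAt_prod hu hwcont fun x => (h x).choose).congr
    (.of_forall fun x => rho_spec (h x) (u x) (w x))

variable {f : X → G₀}

theorem continuousAt_list_prod_vec {ι : Type*} {p : ι → ∀ x, g.Arrow (f x) (f x)}
    (hf : ContinuousAt f x₀) (hp : ∀ i, ContinuousAt (fun x => (p i x).vec) x₀) (l : List ι) :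
    ContinuousAt (fun x => (l.map fun i => p i x).prod.vec) x₀ := by
  induction l with
  | nil => exact continuousAt_id_vec hf
  | cons i l ih => exact continuousAt_prod (hp i) ih _

theorem continuousAt_pow_vec {p : ∀ x, g.Arrow (f x) (f x)} (hf : ContinuousAt f x₀)
    (hp : ContinuousAt (fun x => (p x).vec) x₀) (n : ℕ) :
    ContinuousAt (fun x => (p x ^ n).vec) x₀ := by
  simpa only [List.map_replicate, List.prod_replicate] using
    continuousAt_list_prod_vec hf (fun _ : Unit => hp) (List.replicate n ())

theorem eventually_mem_scalars {p : ∀ x, g.Arrow (f x) (f x)}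
    (hp : ContinuousAt (fun x => (p x).vec) x₀) (h : p x₀ ∈ Arrow.scalars g (f x₀)) :
    ∀ᶠ x in 𝓝 x₀, p x ∈ Arrow.scalars g (f x) := by
  have hproj : Filter.Tendsto (fun x => (p x).vec.1) (𝓝 x₀) (𝓝 (G.e (f x₀))) :=
    Arrow.mem_scalars_iff.1 h ▸ (FiberBundle.continuous_proj ℂ L).continuousAt.comp hp
  filter_upwards [hproj.eventually (G.eventually_eq_e (f x₀))] with x hx
  rw [Arrow.mem_scalars_iff, hx, (p x).s_proj]

theorem exists_eventually_pow_mem_scalars {p : ∀ x, g.Arrow (f x) (f x)} (hf : ContinuousAt f x₀)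
    (hp : ContinuousAt (fun x => (p x).vec) x₀) :
    ∃ n ≠ 0, ∀ᶠ x in 𝓝 x₀, p x ^ n ∈ Arrow.scalars g (f x) := by
  obtain ⟨N, hN⟩ := G.exists_eventually_encard_isotropy_le (f x₀)
  obtain ⟨⟨hindex⟩, -⟩ := Arrow.finiteIndex_scalars_and_index_le (g := g) hN.self_of_nhds
  obtain ⟨n, hn, -, hmem⟩ := Subgroup.exists_pow_mem_of_index_ne_zero hindex (p x₀)
  exact ⟨n, hn.ne', eventually_mem_scalars (continuousAt_pow_vec hf hp n) hmem⟩

end Continuity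

section TorsionSections

theorem smoothOnSubset_loop_pow {W : ∀ v, L v} (hW : ∀ v, W v ≠ 0) {U : Set G₁} (hU : IsOpen U)
    (hWU : ContMDiffOn 𝓘(ℝ, E) (𝓘(ℝ, E).prod 𝓘(ℝ, ℂ)) ∞ (fun x => TotalSpace.mk' ℂ x (W x)) U)
    (n : ℕ) :
    SmoothOnSubset 𝓘(ℝ, E) (𝓘(ℝ, E).prod 𝓘(ℝ, ℂ)) {v | v ∈ U ∧ G.s v = G.t v}
      fun b => (g.loop (a := ⟨b.1, b.2.2⟩) rfl (hW b.1) ^ (n + 1)).vec := by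
  have hbase := smoothOnSubset_of_contMDiffOn hWU hU
    (show {v | v ∈ U ∧ G.s v = G.t v} ⊆ U from fun _ h => h.1)
  induction n with
  | zero =>
    simp only [zero_add, pow_one]
    exact hbase
  | succ n ih =>
    simp only [pow_succ _ (n + 1)]
    exact g.smooth.comp (ih.prodMk hbase) fun b =>
      (g.loop (a := ⟨b.1, b.2.2⟩) rfl (hW b.1) ^ (n + 1)).t_proj

theorem exists_smooth_loop_localFrame_pow_eq [VectorBundle ℝ ℂ L]
    [ContMDiffVectorBundle ∞ ℂ L 𝓘(ℝ, E)] (g : G.Gerbe L) (a : G.Loop) :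
    ∃ n ≠ 0, ∃ c : G₁ → ℂ, (∀ᶠ v in 𝓝 a.1, ContMDiffAt 𝓘(ℝ, E) 𝓘(ℝ, ℂ) ∞ c v) ∧
      ∀ᶠ b in 𝓝 a, ∃ k : ℂˣ, c b.1 = k ∧
        g.loop (a := b) rfl (LineBundle.localFrame_ne_zero (𝕜 := ℂ) a.1 b.1) ^ n = k • 1 := by
  have hval : ContinuousAt (fun b : G.Loop => b.1) a := continuous_subtype_val.continuousAt
  set φ := trivializationAt ℂ L a.1
  have haφ : a.1 ∈ φ.baseSet := mem_baseSet_trivializationAt ℂ L a.1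
  set w : ∀ b : G.Loop, g.Arrow (G.s b.1) (G.s b.1) := fun b =>
    g.loop rfl (LineBundle.localFrame_ne_zero (𝕜 := ℂ) a.1 b.1)
  obtain ⟨n, hn, hmem⟩ := exists_eventually_pow_mem_scalars (p := w)
    (G.continuous_s.continuousAt.comp hval) (LineBundle.continuousAt_localFrame hval)
  obtain ⟨U, hU, haU, F, hF, hFw⟩ := smoothOnSubset_loop_pow (g := g)
    (LineBundle.localFrame_ne_zero a.1) φ.open_baseSet
    (LineBundle.contMDiffOn_localFrame a.1) n ⟨a.1, haφ, a.2⟩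
  have hFsmul {b : G.Loop} (hb : b.1 ∈ φ.baseSet) (hbU : b.1 ∈ U) {k : ℂˣ}
      (hk : w b ^ n = k • 1) :
      F b.1 = ⟨b.1, (k : ℂ) • LineBundle.localFrame ℂ L a.1 b.1⟩ := by
    refine (hFw ⟨b.1, hb, b.2⟩ hbU).trans (congrArg Arrow.vec (?_ : w b ^ (n + 1) = k • w b))
    rw [pow_succ, hk, smul_one_mul]
  obtain ⟨k₀, hk₀⟩ := hmem.self_of_nhds
  have hFa : (F a.1).1 = a.1 := by
    rw [hFsmul haφ haU hk₀.symm]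
  refine ⟨n, hn, fun v => (φ (F v)).2,
    by simpa only [hFa] using LineBundle.eventually_contMDiffAt_coordinate hF hU haU, ?_⟩
  filter_upwards [hmem, hval (hU.mem_nhds haU),
    LineBundle.eventually_mem_baseSet (𝕜 := ℂ) (L := L) hval] with b ⟨k, hk⟩ hbU hb
  refine ⟨k, ?_, hk.symm⟩
  rw [hFsmul hb hbU hk.symm, LineBundle.trivializationAt_smul_localFrame hb]

theorem exists_smooth_torsion_section [VectorBundle ℝ ℂ L]
    [ContMDiffVectorBundle ∞ ℂ L 𝓘(ℝ, E)] (g : G.Gerbe L) (a : G.Loop) :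
    ∃ n, 0 < n ∧ ∃ τ : ∀ v, L v, (∀ᶠ v in 𝓝 a.1, ContMDiffAt 𝓘(ℝ, E) (𝓘(ℝ, E).prod 𝓘(ℝ, ℂ)) ∞
      (fun x => TotalSpace.mk' ℂ x (τ x)) v) ∧ ∀ᶠ b : G.Loop in 𝓝 a, g.IsTorsion n (τ b.1) := by
  obtain ⟨n, hn, c, hc, hpow⟩ := g.exists_smooth_loop_localFrame_pow_eq a
  obtain ⟨k₀, hk₀, -⟩ := hpow.self_of_nhds
  obtain ⟨r, hr, hr_smooth⟩ := exists_contDiffAt_pow_mul_eq_one (hk₀ ▸ k₀.ne_zero) hn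
  refine ⟨n, Nat.pos_of_ne_zero hn, fun v => r (c v) • LineBundle.localFrame ℂ L a.1 v, ?_, ?_⟩
  · filter_upwards [hc, hc.self_of_nhds.continuousAt.eventually hr_smooth,
      (trivializationAt ℂ L a.1).open_baseSet.mem_nhds (mem_baseSet_trivializationAt ℂ L a.1)]
      with v hcv hrv hv
    exact LineBundle.contMDiffAt_smul_localFrame hv
      (((hrv.restrict_scalars ℝ).contMDiffAt).comp v hcv)
  · filter_upwards [hpow] with b ⟨k, hck, hk⟩
    have hroot := hr k k.ne_zero
    have hrk : r k ≠ 0 := ne_zero_pow hn (left_ne_zero_of_mul_eq_one hroot)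
    rw [hck]
    refine ⟨smul_ne_zero hrk (LineBundle.localFrame_ne_zero _ _), ?_⟩
    calc g.loop rfl _ ^ n
        = (Units.mk0 (r k) hrk • g.loop rfl (LineBundle.localFrame_ne_zero a.1 b.1)) ^ n := rfl
      _ = (Units.mk0 (r k) hrk ^ n * k) • 1 := by rw [smul_pow, hk, smul_smul]
      _ = 1 := by rw [show Units.mk0 (r k) hrk ^ n * k = 1 from Units.ext hroot, one_smul]

end TorsionSections

section FlatFrames

variable {X : Type*} [TopologicalSpace X] {x₀ : X}

/-- A family of vectors over a family of loops is flat at `x₀` when it is continuous there and,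
near `x₀`, consists of torsion vectors of bounded order. -/
structure IsFlatAt (g : G.Gerbe L) (a : X → G.Loop) (u : ∀ x, L (a x).1) (x₀ : X) : Prop where
  continuousAt : ContinuousAt (fun x => (⟨(a x).1, u x⟩ : TotalSpace ℂ L)) x₀
  exists_isTorsion : ∃ n, 0 < n ∧ ∀ᶠ x in 𝓝 x₀, g.IsTorsion n (u x)

theorem IsFlatAt.comp {Y : Type*} [TopologicalSpace Y] {f : X → Y} {a : Y → G.Loop}
    {u : ∀ y, L (a y).1} (h : g.IsFlatAt a u (f x₀)) (hf : ContinuousAt f x₀) :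
    g.IsFlatAt (fun x => a (f x)) (fun x => u (f x)) x₀ where
  continuousAt := h.continuousAt.comp hf
  exists_isTorsion := h.exists_isTorsion.imp fun _ ⟨hn, hu⟩ => ⟨hn, hf.eventually hu⟩

theorem IsFlatAt.rho {a b : X → G.Loop} {v : X → G₁} {u : ∀ x, L (a x).1}
    (hu : g.IsFlatAt a u x₀) (hb : ContinuousAt b x₀) (hv : ContinuousAt v x₀)
    (h : ∀ x, G.IsInertiaArrow (a x) (v x) (b x)) :
    g.IsFlatAt b (fun x => g.rho (a x) (b x) (v x) (h x) (u x)) x₀ where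
  continuousAt := continuousAt_rho hb hv hu.continuousAt h
  exists_isTorsion := hu.exists_isTorsion.imp fun _ ⟨hn, hu⟩ =>
    ⟨hn, hu.mono fun x hx => hx.rho (h x)⟩

theorem IsFlatAt.ne_zero {a : X → G.Loop} {u : ∀ x, L (a x).1} (hu : g.IsFlatAt a u x₀) :
    u x₀ ≠ 0 := by
  obtain ⟨n, -, hn⟩ := hu.exists_isTorsion
  exact hn.self_of_nhds.1

theorem IsFlatAt.eventually_eq_smul {a : X → G.Loop} {u u' : ∀ x, L (a x).1} {c : ℂ}
    (hu : g.IsFlatAt a u x₀) (hu' : g.IsFlatAt a u' x₀) (hc : u' x₀ = c • u x₀) :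
    ∀ᶠ x in 𝓝 x₀, u' x = c • u x := by
  obtain ⟨m, hm, hum⟩ := hu.exists_isTorsion
  obtain ⟨n, hn, hun⟩ := hu'.exists_isTorsion
  have hratio (x : X) : ∃ k : ℂ, u x ≠ 0 → u' x = k • u x := by
    by_cases hx : u x = 0
    · exact ⟨0, fun h => absurd hx h⟩
    · exact (LineBundle.exists_smul_eq_of_ne_zero ℂ hx (u' x)).imp fun _ hk _ => hk.symm
  choose k hk using hratio
  have hkcont : ContinuousAt k x₀ := by
    refine LineBundle.continuousAt_of_eventually_eq_smul hu'.continuousAt hu.continuousAt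
      hu.ne_zero ?_
    filter_upwards [hum] with x hx
    rw [hk x hx.1]
  have hroot : ∀ᶠ x in 𝓝 x₀, k x ^ (m * n) = 1 := by
    filter_upwards [hum, hun] with x hx hx'
    exact hx.pow_mul_eq_one hx' (hk x hx.1)
  have hk₀ : k x₀ = c := smul_left_injective ℂ hu.ne_zero ((hk x₀ hu.ne_zero).symm.trans hc)
  filter_upwards [eventually_eq_of_pow_eq_one hkcont (Nat.mul_pos hm hn) hroot, hum] with x hx hux
  rw [hk x hux.1, hx, hk₀]

variable {S : Set G.Loop}

/-- The flat local frames of `L|_S`: those which are locally restrictions of smooth sections of `L`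
and consist of torsion vectors of locally bounded order. -/
structure IsFlatFrame (g : G.Gerbe L) (S : Set G.Loop) (U : Set S) (σ : ∀ a : S, L a.1.1) :
    Prop where
  isOpen : IsOpen U
  exists_isTorsion : ∀ a ∈ U, ∃ n, 0 < n ∧ ∀ᶠ b : S in 𝓝 a, g.IsTorsion n (σ b)
  smooth : ∀ a ∈ U, ∃ (W : Set G₁) (τ : ∀ x : G₁, L x), IsOpen W ∧ a.1.1 ∈ W ∧
    ContMDiffOn 𝓘(ℝ, E) (𝓘(ℝ, E).prod 𝓘(ℝ, ℂ)) ∞ (fun x => TotalSpace.mk' ℂ x (τ x)) W ∧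
    ∀ b ∈ U, b.1.1 ∈ W → σ b = τ b.1.1

theorem IsFlatFrame.isFlatAt {U : Set S} {σ : ∀ a : S, L a.1.1} (h : g.IsFlatFrame S U σ) {a : S}
    (ha : a ∈ U) : g.IsFlatAt (fun b : S => b.1) σ a where
  exists_isTorsion := h.exists_isTorsion a ha
  continuousAt := by
    obtain ⟨W, τ, hW, haW, hτ, hστ⟩ := h.smooth a ha
    have hval : ContinuousAt (fun b : S => b.1.1) a := by fun_prop
    refine ContinuousAt.congr (ContinuousAt.comp' (f := fun b : S => b.1.1)
      (hτ.continuousOn.continuousAt (hW.mem_nhds haW)) hval) ?_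
    filter_upwards [h.isOpen.mem_nhds ha, hval (hW.mem_nhds haW)] with b hb hbW
    exact congrArg (TotalSpace.mk' ℂ b.1.1) (hστ b hb hbW).symm

variable [VectorBundle ℝ ℂ L] [ContMDiffVectorBundle ∞ ℂ L 𝓘(ℝ, E)]

variable (g S) in
theorem exists_isFlatFrame (a : S) : ∃ U σ, g.IsFlatFrame S U σ ∧ a ∈ U := by
  obtain ⟨n, hn, τ, hτ, htorsion⟩ := g.exists_smooth_torsion_section a.1
  obtain ⟨W, hτW, hW, haW⟩ := eventually_nhds_iff.1 hτ
  obtain ⟨V, hτV, hV, haV⟩ := eventually_nhds_iff.1 htorsion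
  refine ⟨{b | b.1.1 ∈ W ∧ b.1 ∈ V}, fun b => τ b.1.1,
    ⟨(hW.preimage (by fun_prop)).inter (hV.preimage (by fun_prop)), fun b hb => ⟨n, hn, ?_⟩,
      fun b hb => ⟨W, τ, hW, hb.1, fun x hx => (hτW x hx).contMDiffWithinAt, fun _ _ _ => rfl⟩⟩,
    haW, haV⟩
  filter_upwards [(hV.preimage (continuous_subtype_val (p := (· ∈ S)))).mem_nhds hb.2] with c hc
  exact hτV c.1 hc

variable (g S) in
/-- The flat line orbibundle on `S` with fibres those of `L` and gluing maps `ρ`. -/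
noncomputable def flatLineOrbibundle : G.FlatLineOrbibundle S (fun a => L a.1.1) where
  finrank_eq_one a := LineBundle.finrank_fiber ℂ L a.1.1
  act a b v hv := g.rho a.1 b.1 v hv
  act_id a u := g.rho_id a.1 u
  act_comp _ _ _ _ _ hv hw h u := rho_comp hv hw h u
  IsFrame := g.IsFlatFrame S
  isOpen_of_isFrame _ _ h := h.isOpen
  frame_ne_zero _ _ h _ ha := (h.isFlatAt ha).ne_zero
  exists_frame := g.exists_isFlatFrame S
  frame_compat _ _ _ _ hσ hτ _ ha _ hc :=
    (hσ.isFlatAt ha.1).eventually_eq_smul (hτ.isFlatAt ha.2) hc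
  act_flat _ σ _ τ hσ hτ p hpU hpV c hc := by
    have hs : ContinuousAt (fun q : G.SectorArrow S => q.1.1) p := by fun_prop
    have ht : ContinuousAt (fun q : G.SectorArrow S => q.1.2.2) p := by fun_prop
    have hσs := (hσ.isFlatAt hpU).comp (f := fun q : G.SectorArrow S => q.1.1) hs
    have hτt := (hτ.isFlatAt hpV).comp (f := fun q : G.SectorArrow S => q.1.2.2) ht
    exact hτt.eventually_eq_smul (hσs.rho (continuous_subtype_val.continuousAt.comp ht)
      (by fun_prop) fun q => q.2) hc

end FlatFrames

section UnitProducts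

variable {n : ℕ}

theorem list_prod_loop_mem_scalars {x : G₀} {γ : Fin n → G.Loop} (h : G.HasUnitProduct γ)
    (hx : ∀ i, G.s (γ i).1 = x) {u : ∀ i, L (γ i).1} (hu : ∀ i, u i ≠ 0) :
    (List.ofFn fun i => g.loop (hx i) (hu i)).prod ∈ Arrow.scalars g x := by
  rcases n with - | n
  · exact one_mem _
  obtain ⟨y, hy, p, h0, hlast, hp⟩ := h.exists_base
  obtain rfl : x = y := (hx 0).symm.trans (hy 0)
  have hpartial (j : Fin (n + 2)) :
      (Fin.partialProd (fun i => g.loop (hx i) (hu i)) j).vec.1 = p j := by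
    induction j using Fin.induction with
    | zero => rw [Fin.partialProd_zero, h0, Arrow.one_eq_id, Arrow.id_vec_proj]
    | succ i ih =>
      obtain ⟨hi, hpi⟩ := hp i
      rw [Fin.partialProd_succ, hpi]
      exact mul_congr ih rfl _ hi
  have htotal : Fin.partialProd (fun i => g.loop (hx i) (hu i)) (Fin.last (n + 1)) =
      (List.ofFn fun i => g.loop (hx i) (hu i)).prod := by
    rw [Fin.partialProd, List.take_of_length_le (by simp)]
  rw [← htotal, Arrow.mem_scalars_iff, hpartial, hlast]

theorem exists_multilinearMap_list_prod_loop {x : G₀} {γ : Fin n → G.Loop}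
    (h : G.HasUnitProduct γ) (hx : ∀ i, G.s (γ i).1 = x) :
    ∃ φ : MultilinearMap ℂ (fun i => L (γ i).1) ℂ, ∀ (u : ∀ i, L (γ i).1) (hu : ∀ i, u i ≠ 0),
      ∃ c : ℂˣ, (List.ofFn fun i => g.loop (hx i) (hu i)).prod = c • 1 ∧ φ u = c := by
  have hscalar (u : ∀ i, {u : L (γ i).1 // u ≠ 0}) :
      ∃ c : ℂˣ, (List.ofFn fun i => g.loop (hx i) (u i).2).prod = c • 1 :=
    (list_prod_loop_mem_scalars h hx fun i => (u i).2).imp fun _ hc => hc.symm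
  choose c hc using hscalar
  obtain ⟨φ, hφ⟩ := exists_multilinearMap_eq_of_homogeneous
    (fun i => LineBundle.finrank_fiber ℂ L (γ i).1) (fun u => (c u : ℂ)) fun k u w hw => by
      have hprod : c w • (1 : g.Arrow x x) = ((∏ i, k i) * c u) • 1 := by
        rw [mul_smul, ← hc u, ← hc w, ← list_prod_ofFn_smul]
        congr 2
        funext i
        exact loop_congr (hx i) (hw i) _ _
      simpa using congrArg Units.val (Arrow.smul_left_cancel hprod)
  exact ⟨φ, fun u hu => ⟨_, hc fun i => ⟨u i, hu i⟩, hφ fun i => ⟨u i, hu i⟩⟩⟩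

variable [NeZero n]

variable (g) in
/-- The product of vectors over loops `γ₁, …, γₙ` with `γ₁ ⋯ γₙ = 1`: it lies in the fibre of `L`
over a unit arrow, which the gerbe identifies with `ℂ`. -/
noncomputable def unitProductForm {γ : Fin n → G.Loop} (h : G.HasUnitProduct γ) :
    MultilinearMap ℂ (fun i => L (γ i).1) ℂ :=
  (g.exists_multilinearMap_list_prod_loop h fun i => h.s_eq i 0).choose

theorem exists_list_prod_loop_eq_smul_one {x : G₀} {γ : Fin n → G.Loop} (h : G.HasUnitProduct γ)
    (hx : ∀ i, G.s (γ i).1 = x) {u : ∀ i, L (γ i).1} (hu : ∀ i, u i ≠ 0) :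
    ∃ c : ℂˣ, (List.ofFn fun i => g.loop (hx i) (hu i)).prod = c • 1 ∧
      g.unitProductForm h u = c := by
  obtain rfl := hx 0
  exact (g.exists_multilinearMap_list_prod_loop h fun i => h.s_eq i 0).choose_spec u hu

theorem unitProductForm_ne_zero {γ : Fin n → G.Loop} (h : G.HasUnitProduct γ) {u : ∀ i, L (γ i).1}
    (hu : ∀ i, u i ≠ 0) : g.unitProductForm h u ≠ 0 := by
  obtain ⟨c, -, hc⟩ := g.exists_list_prod_loop_eq_smul_one h (fun i => h.s_eq i 0) hu
  exact hc ▸ c.ne_zero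

theorem unitProductForm_rho {γ γ' : Fin n → G.Loop} {z : G₁} (h : G.HasUnitProduct γ)
    (h' : G.HasUnitProduct γ') (hz : ∀ i, G.IsInertiaArrow (γ i) z (γ' i)) (u : ∀ i, L (γ i).1) :
    g.unitProductForm h' (fun i => g.rho (γ i) (γ' i) z (hz i) (u i)) =
      g.unitProductForm h u := by
  by_cases hu : ∀ i, u i ≠ 0
  · obtain ⟨w, hw⟩ := Arrow.exists_vec_proj_eq g (hz 0).s_eq (hz 0).t_eq
    obtain ⟨c, hprod, hc⟩ := g.exists_list_prod_loop_eq_smul_one h (fun i => h.s_eq i 0) hu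
    obtain ⟨c', hprod', hc'⟩ := g.exists_list_prod_loop_eq_smul_one h' (fun i => h'.s_eq i 0)
      fun i => rho_ne_zero (hz i) (hu i)
    have hconj : c' • (1 : g.Arrow (G.s (γ' 0).1) (G.s (γ' 0).1)) = c • 1 := by
      calc c' • 1 = Arrow.conj w (List.ofFn fun i => g.loop (h.s_eq i 0) (hu i)).prod := by
            rw [← hprod', map_list_prod, List.map_ofFn]
            congr 2
            funext i
            exact loop_rho (hz i) (h.s_eq i 0) (h'.s_eq i 0) (hu i) hw
        _ = c • 1 := by rw [hprod, Arrow.conj_smul, map_one]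
    rw [hc, hc', Arrow.smul_left_cancel hconj]
  · push Not at hu
    obtain ⟨i, hi⟩ := hu
    rw [MultilinearMap.map_coord_zero _ i hi, MultilinearMap.map_coord_zero _ i]
    rw [hi, map_zero]

section Continuity

variable {X : Type*} [TopologicalSpace X] {x₀ : X} {γ : X → Fin n → G.Loop}
  {u : ∀ x i, L (γ x i).1}

theorem continuousAt_unitProductForm_of_ne_zero (h : ∀ x, G.HasUnitProduct (γ x))
    (hu : ∀ x i, u x i ≠ 0)
    (hcont : ∀ i, ContinuousAt (fun x => (⟨(γ x i).1, u x i⟩ : TotalSpace ℂ L)) x₀) :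
    ContinuousAt (fun x => g.unitProductForm (h x) (u x)) x₀ := by
  have hbase : ContinuousAt (fun x => G.s (γ x 0).1) x₀ :=
    (G.continuous_s.comp (FiberBundle.continuous_proj ℂ L)).continuousAt.comp (hcont 0)
  have hprod : ContinuousAt
      (fun x => (List.ofFn fun i => g.loop ((h x).s_eq i 0) (hu x i)).prod.vec) x₀ := by
    simpa only [List.ofFn_eq_map] using
      continuousAt_list_prod_vec (g := g) (p := fun i x => g.loop ((h x).s_eq i 0) (hu x i))
        hbase hcont (List.finRange n)
  refine LineBundle.continuousAt_of_eventually_eq_smul hprod (continuousAt_id_vec (g := g) hbase)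
    (Arrow.id g _).vec_ne_zero (.of_forall fun x => ?_)
  obtain ⟨c, hc, hcu⟩ := g.exists_list_prod_loop_eq_smul_one (h x) (fun i => (h x).s_eq i 0) (hu x)
  rw [hc, hcu]
  rfl

theorem continuousAt_unitProductForm (h : ∀ x, G.HasUnitProduct (γ x))
    (hcont : ∀ i, ContinuousAt (fun x => (⟨(γ x i).1, u x i⟩ : TotalSpace ℂ L)) x₀) :
    ContinuousAt (fun x => g.unitProductForm (h x) (u x)) x₀ := by
  have hγ (i : Fin n) : ContinuousAt (fun x => (γ x i).1) x₀ :=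
    (FiberBundle.continuous_proj ℂ L).continuousAt.comp (hcont i)
  choose w hw hwcont using fun i => exists_continuousAt_ne_zero (L := L) (hγ i)
  choose k hk using fun x i => LineBundle.exists_smul_eq_of_ne_zero ℂ (hw i x) (u x i)
  have hkcont (i : Fin n) : ContinuousAt (fun x => k x i) x₀ :=
    LineBundle.continuousAt_of_eventually_eq_smul (hcont i) (hwcont i) (hw i x₀)
      (.of_forall fun x => by rw [hk])
  have hform (x : X) : (∏ i, k x i) * g.unitProductForm (h x) (fun i => w i x) =
      g.unitProductForm (h x) (u x) := by
    rw [← smul_eq_mul, ← MultilinearMap.map_smul_univ, funext (hk x)]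
  refine ContinuousAt.congr ?_ (.of_forall hform)
  exact (tendsto_finsetProd Finset.univ fun i _ => hkcont i).mul
    (continuousAt_unitProductForm_of_ne_zero (g := g) h (fun x i => hw i x) hwcont)

theorem exists_eventually_unitProductForm_pow_eq_one (h : ∀ x, G.HasUnitProduct (γ x))
    (hu : ∀ i, g.IsFlatAt (fun x => γ x i) (fun x => u x i) x₀) :
    ∃ N, 0 < N ∧ ∀ᶠ x in 𝓝 x₀, g.unitProductForm (h x) (u x) ^ N = 1 := by
  choose m hm hum using fun i => (hu i).exists_isTorsion
  have hbase : ContinuousAt (fun x => G.s (γ x 0).1) x₀ :=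
    (G.continuous_s.comp (FiberBundle.continuous_proj ℂ L)).continuousAt.comp (hu 0).continuousAt
  obtain ⟨N, hN⟩ := G.exists_eventually_encard_isotropy_le (G.s (γ x₀ 0).1)
  refine ⟨N.factorial * ∏ i, m i,
    Nat.mul_pos N.factorial_pos (Finset.prod_pos fun i _ => hm i), ?_⟩
  filter_upwards [Filter.eventually_all.2 hum, hbase.eventually hN] with x hux hNx
  obtain ⟨c, hprod, hc⟩ := g.exists_list_prod_loop_eq_smul_one (h x) (fun i => (h x).s_eq i 0)
    fun i => (hux i).1
  have hroot : c ^ (N.factorial * ∏ i, m i) •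
      (1 : g.Arrow (G.s (γ x 0).1) (G.s (γ x 0).1)) = (1 : ℂˣ) • 1 := by
    rw [← one_pow (N.factorial * ∏ i, m i), ← smul_pow, ← hprod, one_pow, one_smul]
    refine Arrow.list_prod_pow_factorial_mul_eq_one hNx (List.forall_mem_ofFn_iff.2 fun i => ?_)
    obtain ⟨k, hk⟩ := Finset.dvd_prod_of_mem m (Finset.mem_univ i)
    rw [hk, pow_mul, (hux i).loop_pow_eq_one, one_pow]
  rw [hc]
  exact congrArg Units.val (Arrow.smul_left_cancel hroot)

theorem eventually_unitProductForm_eq (h : ∀ x, G.HasUnitProduct (γ x))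
    (hu : ∀ i, g.IsFlatAt (fun x => γ x i) (fun x => u x i) x₀) :
    ∀ᶠ x in 𝓝 x₀, g.unitProductForm (h x) (u x) = g.unitProductForm (h x₀) (u x₀) := by
  obtain ⟨N, hN, hpow⟩ := exists_eventually_unitProductForm_pow_eq_one h hu
  exact eventually_eq_of_pow_eq_one
    (continuousAt_unitProductForm h fun i => (hu i).continuousAt) hN hpow

end Continuity

end UnitProducts

section SectorForms

theorem rho_inv_rho_of_mul_eq {a b a' b' : G.Loop} {v v' y z : G₁} (hv : G.IsInertiaArrow a v b)
    (hv' : G.IsInertiaArrow a' v' b') (hy : G.IsInertiaArrow b y b')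
    (hz : G.IsInertiaArrow a z a') {h : G.t v = G.s y} {h' : G.t z = G.s v'}
    (heq : G.mul v y h = G.mul z v' h') (u : L b.1) :
    g.rho b' a' (G.inv v') hv'.inv (g.rho b b' y hy u) =
      g.rho a a' z hz (g.rho b a (G.inv v) hv.inv u) := by
  have hrho {w w' : G₁} (hw : w = w') (hb : G.IsInertiaArrow b w a')
      (hb' : G.IsInertiaArrow b w' a') : g.rho b a' w hb u = g.rho b a' w' hb' u := by
    subst hw
    rfl
  have hyv : G.t y = G.s (G.inv v') := hy.t_eq.trans hv'.inv.s_eq.symm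
  have hvz : G.t (G.inv v) = G.s z := hv.inv.t_eq.trans hz.s_eq.symm
  rw [← rho_comp hy hv'.inv hyv, ← rho_comp hv.inv hz hvz]
  exact hrho (mul_inv_eq_inv_mul heq hyv hvz) _ _

variable {S : Set G.Loop} {n : ℕ} [NeZero n]

variable (g) in
/-- The product of vectors over the `bᵢ` of an object of the multisector, once transported to the
`gᵢ` along the arrows `vᵢ : gᵢ ⟶ bᵢ`. -/
noncomputable def sectorForm (q : G.MultiSector S n) :
    MultilinearMap ℂ (fun i => L (q.1.2.2 i).1.1) ℂ :=
  (g.unitProductForm q.2.1).compLinearMap fun i =>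
    g.rho (q.1.2.2 i).1 (q.1.1 i) (G.inv (q.1.2.1 i)) (q.2.2 i).inv

theorem sectorForm_ne_zero (q : G.MultiSector S n) {u : ∀ i, L (q.1.2.2 i).1.1}
    (hu : ∀ i, u i ≠ 0) : g.sectorForm q u ≠ 0 :=
  unitProductForm_ne_zero q.2.1 fun i => rho_ne_zero (q.2.2 i).inv (hu i)

theorem sectorForm_rho {q q' : G.MultiSector S n} {z : G₁} {y : Fin n → G₁}
    (h : G.IsMultiSectorArrow q q' z y) (u : ∀ i, L (q.1.2.2 i).1.1) :
    g.sectorForm q' (fun i => g.rho (q.1.2.2 i).1 (q'.1.2.2 i).1 (y i) (h i).2.1 (u i)) =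
      g.sectorForm q u := by
  refine Eq.trans ?_ (unitProductForm_rho q.2.1 q'.2.1 (fun i => (h i).1) _)
  refine congrArg (g.unitProductForm q'.2.1) (funext fun i => ?_)
  obtain ⟨hz, hy, k, k', heq⟩ := h i
  exact rho_inv_rho_of_mul_eq (q.2.2 i) (q'.2.2 i) hy hz heq (u i)

theorem eventually_sectorForm_eq {q : G.MultiSector S n} {σ : Fin n → ∀ a : S, L a.1.1}
    (hσ : ∀ i, g.IsFlatAt (fun a : S => a.1) (σ i) (q.1.2.2 i)) :
    ∀ᶠ r : G.MultiSector S n in 𝓝 q, g.sectorForm r (fun i => σ i (r.1.2.2 i)) =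
      g.sectorForm q (fun i => σ i (q.1.2.2 i)) := by
  refine eventually_unitProductForm_eq (fun r : G.MultiSector S n => r.2.1) fun i => ?_
  have hb : ContinuousAt (fun r : G.MultiSector S n => r.1.2.2 i) q := by fun_prop
  have hv : ContinuousAt (fun r : G.MultiSector S n => G.inv (r.1.2.1 i)) q :=
    G.inv_smooth.continuous.continuousAt.comp (by fun_prop)
  exact ((hσ i).comp (f := fun r : G.MultiSector S n => r.1.2.2 i) hb).rho (by fun_prop) hv
    fun r => (r.2.2 i).inv

variable [VectorBundle ℝ ℂ L] [ContMDiffVectorBundle ∞ ℂ L 𝓘(ℝ, E)]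

variable (g S n) in
/-- The flat trivialization over the `n`-fold multisector given by multiplication in the central
extension. -/
noncomputable def flatTrivialization : FlatTrivialization (g.flatLineOrbibundle S) n where
  form := g.sectorForm
  form_ne_zero q _ hu := sectorForm_ne_zero q hu
  form_invariant _ _ _ _ h u := sectorForm_rho h u
  form_flat _ _ hσ _ hq := eventually_sectorForm_eq fun i => (hσ i).isFlatAt (hq i)

variable (g S) in
/-- The inner local system on `S` with fibres those of `L` and gluing maps `ρ`. -/
noncomputable def innerLocalSystem : G.InnerLocalSystem S (fun a => L a.1.1) where
  toFlatLineOrbibundle := g.flatLineOrbibundle S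
  nontwisted := g.flatTrivialization S 1
  inversion := g.flatTrivialization S 2
  triple := g.flatTrivialization S 3

end SectorForms

end OrbifoldGroupoid.Gerbe

theorem mainTheorem5_general {E G₀ G₁ : Type*}
    [NormedAddCommGroup E] [NormedSpace ℝ E] [TopologicalSpace G₀] [ChartedSpace E G₀]
    [TopologicalSpace G₁] [ChartedSpace E G₁] (G : OrbifoldGroupoid E G₀ G₁) (L : G₁ → Type*)
    [∀ a, AddCommGroup (L a)] [∀ a, Module ℂ (L a)] [∀ a, TopologicalSpace (L a)]
    [TopologicalSpace (TotalSpace ℂ L)] [FiberBundle ℂ L] [VectorBundle ℂ ℂ L]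
    [VectorBundle ℝ ℂ L] [ContMDiffVectorBundle ∞ ℂ L 𝓘(ℝ, E)]
    (g : G.Gerbe L) (S : Set G.Loop) :
    ∃ B : G.InnerLocalSystem S (fun a => L a.1.1),
      (∀ (a b : S) (v : G₁) (hv : G.IsInertiaArrow a.1 v b.1),
        B.act a b v hv = g.rho a.1 b.1 v hv) ∧
      ∀ (U : Set S) (σ : ∀ a : S, L a.1.1), B.IsFrame U σ → ∀ a ∈ U,
        ∃ (W : Set G₁) (τ : ∀ x : G₁, L x), IsOpen W ∧ a.1.1 ∈ W ∧
          ContMDiffOn 𝓘(ℝ, E) (𝓘(ℝ, E).prod 𝓘(ℝ, ℂ)) ∞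
            (fun x => TotalSpace.mk' ℂ x (τ x)) W ∧
          ∀ b ∈ U, b.1.1 ∈ W → σ b = τ b.1.1 :=
  ⟨g.innerLocalSystem S, fun _ _ _ _ => rfl, fun _ _ h => h.smooth⟩

theorem mainTheorem5 {E G₀ G₁ : Type*}
    [NormedAddCommGroup E] [NormedSpace ℝ E] [FiniteDimensional ℝ E]
    [TopologicalSpace G₀] [T2Space G₀] [ChartedSpace E G₀] [IsManifold 𝓘(ℝ, E) ∞ G₀]
    [TopologicalSpace G₁] [T2Space G₁] [ChartedSpace E G₁] [IsManifold 𝓘(ℝ, E) ∞ G₁]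
    (G : OrbifoldGroupoid E G₀ G₁)
    (L : G₁ → Type*)
    [∀ a, AddCommGroup (L a)] [∀ a, Module ℂ (L a)] [∀ a, TopologicalSpace (L a)]
    [TopologicalSpace (TotalSpace ℂ L)] [FiberBundle ℂ L] [VectorBundle ℂ ℂ L]
    [VectorBundle ℝ ℂ L] [ContMDiffVectorBundle ∞ ℂ L 𝓘(ℝ, E)]
    (g : G.Gerbe L) (S : Set G.Loop) (hS : G.IsTwistedSectors S) :
    ∃ B : G.InnerLocalSystem S (fun a => L a.1.1),
      (∀ (a b : S) (v : G₁) (hv : G.IsInertiaArrow a.1 v b.1),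
        B.act a b v hv = g.rho a.1 b.1 v hv) ∧
      ∀ (U : Set S) (σ : ∀ a : S, L a.1.1), B.IsFrame U σ → ∀ a ∈ U,
        ∃ (W : Set G₁) (τ : ∀ x : G₁, L x), IsOpen W ∧ a.1.1 ∈ W ∧
          ContMDiffOn 𝓘(ℝ, E) (𝓘(ℝ, E).prod 𝓘(ℝ, ℂ)) ∞
            (fun x => TotalSpace.mk' ℂ x (τ x)) W ∧
          ∀ b ∈ U, b.1.1 ∈ W → σ b = τ b.1.1 :=
  mainTheorem5_general G L g S
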